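/- Let $n\ge 2$, $M\ge 1$, $N\ge 0$ be integers and let $A_1,\dots,A_M\in\mathbb R^{n\times n}$ have joint spectral radius $\rho(\mathcal A)=\lim_{k\to\infty}\max_{\sigma}\|A_{\sigma(k-1)}\cdots A_{\sigma(0)}\|^{1/k}<1$. Let $X\subset\mathbb R^n$ be a (convex, bounded) polytope with the origin in its interior. For a set $S$ write $\|x\|_S=\inf\{\lambda\ge 0: x\in\lambda S\}$. For a sample $\omega_N=((x_i,\sigma_i))_{i=1}^N$ in $\mathbb S_{n-1}\times\{1,\dots,M\}$ put $\tilde R_0=X$ and $$\tilde R_{k+1}=\mathrm{conv}\Big(\tilde R_k\cup\Big\{\tfrac{A_{\sigma_i}x_i}{\|x_i\|_{\tilde R_k}}\Big\}_{i}\cup\Big\{\tfrac{-A_{\sigma_i}x_i}{\|-x_i\|_{\tilde R_k}}\Big\}_{i}\Big),$$ and let $\tilde R_\infty(\omega_N)$ be the limit of this increasing sequence (the closure of $\bigcup_k\tilde R_k$). Let $\mathcal I(x;a,b)=\int_0^x t^{a-1}(1-t)^{b-1}dt\,/\int_0^1 t^{a-1}(1-t)^{b-1}dt$, and let $\mathcal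 I^{-1}(\cdot\,;a,b)$ be its inverse in $x\in[0,1]$. For $\epsilon\in(0,1/2)$ let $\delta(\epsilon)=\sqrt{1-\mathcal I^{-1}(2\epsilon;\tfrac{n-1}2,\tfrac12)}$ and $\theta(\epsilon)=\arccos\delta(\epsilon)$ (a spherical cap of angle $\theta(\epsilon)$ has normalized measure $\epsilon$). For a polytope $S$ with the origin in its interior and vertex set $\mathcal V(S)$ let $$\underline\gamma(S,\epsilon)=\min_{u\in\mathcal V(S)}\frac{\delta(\epsilon)}{\|u\|}\,\min\{\|x\|: x\in\partial S,\ u^Tx\ge\|x\|\|u\|\cos\theta(\epsilon)\}.$$ Suppose that $\omega_N$ consists of $N$ independent samples from the uniform distribution on $\mathbb S_{n-1}\times\{1,\dots,M\}$. Then, for every $\epsilon\in(0,1/2)$ with $2\theta(\epsilon)<\pi/2$, with probability at least $1-\mathcal B(\epsilon;N)$, where $$\mathcal B(\epsilon;N)=\frac{2M(1-\epsilon/M)^N}{\mathcal I(\sin^2(\theta(\epsilon)/2);\frac{n-1}2,\frac12)},$$ the set $\tilde R_\infty(\omega_N)$ is $\lambda$-contractive, i.e. $A_\sigma\tilde R_\infty(\omega_N)\subseteq\lambda\tilde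 R_\infty(\omega_N)$ for all $\sigma\in\{1,\dots,M\}$, with $$\lambda=\frac1{\underline\gamma\big(\tilde R_\infty(\omega_N),\ \tfrac12\mathcal I(\sin^2(2\theta(\epsilon));\tfrac{n-1}2,\tfrac12)\big)}.$$ -/

import Mathlib

open MeasureTheory Set Filter Topology
open scoped Pointwise

noncomputable section

/-- `ℝⁿ` with the Euclidean norm. -/
abbrev Euc (n : ℕ) : Type := EuclideanSpace ℝ (Fin n)

/-- The unit sphere `𝕊_{n-1}` of `ℝⁿ`, as a type. -/
abbrev USphere (n : ℕ) : Type := Metric.sphere (0 : Euc n) 1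

/-- The linear action `x ↦ A x` of a matrix on `ℝⁿ`. -/
def act {n : ℕ} (A : Matrix (Fin n) (Fin n) ℝ) : Euc n →L[ℝ] Euc n :=
  Matrix.toEuclideanCLM (𝕜 := ℝ) A

/-! ### Switched linear systems -/

/-- The product `A_{σ(k-1)} ⋯ A_{σ(1)} A_{σ(0)}` along a switching sequence of length `k`. -/
def switchProd {n M k : ℕ} (A : Fin M → Matrix (Fin n) (Fin n) ℝ) (σ : Fin k → Fin M) :
    Matrix (Fin n) (Fin n) ℝ :=
  (List.ofFn fun i : Fin k => A (σ i.rev)).prod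

/-- The joint spectral radius `lim_k max_σ ‖A_{σ(k-1)} ⋯ A_{σ(0)}‖^{1/k}` (Euclidean operator norm).
The sequence converges by submultiplicativity, so that its limit is its upper limit. -/
def jointSpectralRadius {n M : ℕ} (A : Fin M → Matrix (Fin n) (Fin n) ℝ) : ℝ :=
  limsup (fun k : ℕ => (⨆ σ : Fin k → Fin M, ‖act (switchProd A σ)‖) ^ (1 / (k : ℝ))) atTop

/-- `S` is `lam`-contractive for the switched system: `A_σ S ⊆ lam S` for every mode `σ`. -/
def IsContractive {n M : ℕ} (A : Fin M → Matrix (Fin n) (Fin n) ℝ) (lam : ℝ) (S : Set (Euc n)) :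
    Prop :=
  ∀ x ∈ S, ∀ σ : Fin M, act (A σ) x ∈ lam • S

/-- A C-polytope: the convex hull of finitely many points, with the origin in its interior. -/
def IsCPolytope {n : ℕ} (S : Set (Euc n)) : Prop :=
  (∃ t : Finset (Euc n), S = convexHull ℝ (t : Set (Euc n))) ∧ (0 : Euc n) ∈ interior S

/-! ### The data-driven geometric algorithm -/

/-- The points `A_σ x / ‖x‖_R` and `-A_σ x / ‖-x‖_R` for `(x, σ)` in the sample. Here
`‖·‖_R` is the Minkowski gauge of `R`. -/
def sampleImages {n M N : ℕ} (A : Fin M → Matrix (Fin n) (Fin n) ℝ)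
    (ω : Fin N → USphere n × Fin M) (R : Set (Euc n)) : Set (Euc n) :=
  {y | ∃ i : Fin N, y = (gauge R ((ω i).1 : Euc n))⁻¹ • act (A (ω i).2) ((ω i).1 : Euc n)} ∪
  {y | ∃ i : Fin N, y = (gauge R (-((ω i).1 : Euc n)))⁻¹ • (-act (A (ω i).2) ((ω i).1 : Euc n))}

/-- The iterates `R̃_k(ω)`: `R̃_0 = X` and `R̃_{k+1} = conv (R̃_k ∪ Ω_k)`. -/
def dataHull {n M N : ℕ} (A : Fin M → Matrix (Fin n) (Fin n) ℝ) (X : Set (Euc n))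
    (ω : Fin N → USphere n × Fin M) : ℕ → Set (Euc n)
  | 0 => X
  | k + 1 => convexHull ℝ (dataHull A X ω k ∪ sampleImages A ω (dataHull A X ω k))

theorem dataHull_mono {n M N : ℕ} (A : Fin M → Matrix (Fin n) (Fin n) ℝ) (X : Set (Euc n))
    (ω : Fin N → USphere n × Fin M) : Monotone (dataHull A X ω) :=
  monotone_nat_of_le_succ fun _ => subset_union_left.trans (subset_convexHull ℝ _)

/-- The limit `R̃_∞(ω)`. The iterates increase, so their limit (for the Hausdorff distance, as soon
as they stay bounded) is the closure of their union. -/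
def dataHullLimit {n M N : ℕ} (A : Fin M → Matrix (Fin n) (Fin n) ℝ) (X : Set (Euc n))
    (ω : Fin N → USphere n × Fin M) : Set (Euc n) :=
  closure (⋃ k, dataHull A X ω k)

/-! ### Random samples -/

/-- The uniform probability measure on the unit sphere: normalized surface measure. -/
def sphereUniform (n : ℕ) : Measure (USphere n) :=
  ((volume : Measure (Euc n)).toSphere univ)⁻¹ • (volume : Measure (Euc n)).toSphere

/-- The uniform distribution on `𝕊_{n-1} × {1, …, M}`. -/
def sampleLaw (n M : ℕ) : Measure (USphere n × Fin M) :=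
  (sphereUniform n).prod (ProbabilityTheory.uniformOn (univ : Set (Fin M)))

/-- The law of `N` independent uniform samples. -/
def sampleLawN (n M N : ℕ) : Measure (Fin N → USphere n × Fin M) :=
  Measure.pi fun _ => sampleLaw n M

/-! ### Incomplete beta function, angles, and the contraction rate -/

/-- The regularized incomplete beta function `I(x; a, b)`. -/
def regIncBeta (x a b : ℝ) : ℝ :=
  (∫ t in (0 : ℝ)..x, t ^ (a - 1) * (1 - t) ^ (b - 1)) /
    ∫ t in (0 : ℝ)..1, t ^ (a - 1) * (1 - t) ^ (b - 1)

/-- The inverse `I⁻¹(y; a, b)` of `x ↦ I(x; a, b)` on `[0, 1]`. -/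
def regIncBetaInv (y a b : ℝ) : ℝ :=
  Function.invFunOn (fun x => regIncBeta x a b) (Icc 0 1) y

/-- `δ(ε) = √(1 - I⁻¹(2ε; (n-1)/2, 1/2))`. -/
def capDelta (n : ℕ) (ε : ℝ) : ℝ :=
  √(1 - regIncBetaInv (2 * ε) (((n : ℝ) - 1) / 2) (1 / 2))

/-- `θ(ε) = arccos δ(ε)`, the angle of a spherical cap of measure `ε`. -/
def capTheta (n : ℕ) (ε : ℝ) : ℝ := Real.arccos (capDelta n ε)

/-- The cone `C(u, θ) = {x : uᵀ x ≥ ‖x‖ ‖u‖ cos θ}`. -/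
def dirCone {n : ℕ} (u : Euc n) (θ : ℝ) : Set (Euc n) :=
  {x | ‖x‖ * ‖u‖ * Real.cos θ ≤ inner ℝ u x}

/-- `d_min(u, S, ε) = min {‖x‖ : x ∈ ∂S ∩ C(u, θ(ε))}`. -/
def dMin {n : ℕ} (u : Euc n) (S : Set (Euc n)) (ε : ℝ) : ℝ :=
  sInf ((fun x : Euc n => ‖x‖) '' (frontier S ∩ dirCone u (capTheta n ε)))

/-- `γ̲(S, ε)`, the minimum of `δ(ε) d_min(u, S, ε) / ‖u‖` over the vertices `u` of `S`. -/
def gammaLower {n : ℕ} (S : Set (Euc n)) (ε : ℝ) : ℝ :=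
  sInf ((fun u : Euc n => capDelta n ε * dMin u S ε / ‖u‖) '' (S.extremePoints ℝ))

/-- `B(ε; N) = 2 M (1 - ε/M)^N / I(sin²(θ(ε)/2); (n-1)/2, 1/2)`. -/
def failureBound (n M N : ℕ) (ε : ℝ) : ℝ :=
  2 * (M : ℝ) * (1 - ε / (M : ℝ)) ^ N /
    regIncBeta (Real.sin (capTheta n ε / 2) ^ 2) (((n : ℝ) - 1) / 2) (1 / 2)

/-- `I(sin²(2θ(ε)); (n-1)/2, 1/2) / 2`, the measure of a spherical cap of angle `2θ(ε)`
when `2θ(ε) ≤ π/2`. -/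
def doubledMeasure (n : ℕ) (ε : ℝ) : ℝ :=
  regIncBeta (Real.sin (2 * capTheta n ε) ^ 2) (((n : ℝ) - 1) / 2) (1 / 2) / 2

end

/-! Deterministic half. Let S be the limit set. It is compact and convex with 0 in its interior, and
a sampled vector y of mode σ (or its opposite) satisfies ‖A_σ y‖_S ≤ ‖y‖_S. Call a unit vector v bad
for the angle r if the sampled vectors of mode σ within angle r of v lie in an open half-space {e·y
< 0} with e·v ≥ 0. If v = u/‖u‖ is not bad for 2θ, separation puts some multiple t v in the convex
hull of the sampled vectors within angle 2θ of v, and t ≥ cos 2θ. These vectors have gauge at most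
1/d_min(u), so ‖A_σ u‖_S ≤ ‖u‖ / (cos 2θ · d_min(u)). Taking u over the extreme points and applying
Krein–Milman gives the contraction rate (`map_mem_smul_of_spread`).

Probabilistic half. It remains to exclude bad directions for 2θ. Write 2θ = θ/2 + 3θ/2. One bad
direction for 2θ forces the bad directions for 3θ/2 to have measure at least that of a cap of angle
θ/2 (`capMeasure_le_badDirections`). By Fubini and Markov, this has probability at most b /
cap(θ/2), where b bounds the probability that a fixed direction is bad for 3θ/2. A union over the
modes gives M b / cap(θ/2), which is the failure bound as soon as b ≤ (1 - ε/M)^N.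

A fixed u is bad only if the projections to u^⊥ of the relevant samples lie in an open half-space.
The reflection through the line of u makes these projections symmetric, so Wendel's argument bounds
the probability (`measureReal_halfSpaceEvent_le`). The larger cap of angle 3θ/2 gives a decay rate
that beats 1 - ε/M, and the surplus absorbs the dimensional prefactor whenever the failure bound is
below 1 (`exists_wendel_parameters`, `wendel_le_failure`). -/

/-! ### The incomplete beta function and the integral of a power of the sine -/

/-- The integral `∫₀^θ sin^k`. -/
noncomputable def sinPowInt (k : ℕ) (θ : ℝ) : ℝ := ∫ t in (0 : ℝ)..θ, Real.sin t ^ k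

theorem hasDerivAt_sinPowInt (k : ℕ) (θ : ℝ) :
    HasDerivAt (sinPowInt k) (Real.sin θ ^ k) θ :=
  intervalIntegral.integral_hasDerivAt_right (Continuous.intervalIntegrable (by fun_prop) _ _)
    (Continuous.stronglyMeasurableAtFilter (by fun_prop) _ _) (by fun_prop)

theorem continuous_sinPowInt (k : ℕ) : Continuous (sinPowInt k) :=
  continuous_iff_continuousAt.2 fun θ => (hasDerivAt_sinPowInt k θ).continuousAt

@[simp]
theorem sinPowInt_zero (k : ℕ) : sinPowInt k 0 = 0 := by simp [sinPowInt]

theorem strictMonoOn_sinPowInt (k : ℕ) : StrictMonoOn (sinPowInt k) (Icc 0 Real.pi) := by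
  refine strictMonoOn_of_deriv_pos (convex_Icc _ _) (continuous_sinPowInt k).continuousOn ?_
  intro x hx
  rw [interior_Icc] at hx
  rw [(hasDerivAt_sinPowInt k x).deriv]
  exact pow_pos (Real.sin_pos_of_mem_Ioo hx) k

theorem sinPowInt_pos (k : ℕ) {θ : ℝ} (h0 : 0 < θ) (h1 : θ ≤ Real.pi) : 0 < sinPowInt k θ := by
  simpa using strictMonoOn_sinPowInt k ⟨le_rfl, Real.pi_pos.le⟩ ⟨h0.le, h1⟩ h0

/-- The right-hand side is what the chain rule yields for the derivative of 2 ∫₀^{arcsin √t}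
sin^(n-2). -/
theorem betaIntegrand_eq {n : ℕ} (hn : 2 ≤ n) {t : ℝ} (h0 : 0 < t) (h1 : t < 1) :
    t ^ (((n : ℝ) - 1) / 2 - 1) * (1 - t) ^ ((1 : ℝ) / 2 - 1) =
      2 * (√t ^ (n - 2) * (1 / √(1 - √t ^ 2) * (1 / (2 * √t)))) := by
  have e1 : t ^ (((n : ℝ) - 1) / 2 - 1) = √t ^ (n - 2) * (√t)⁻¹ := by
    rw [Real.sqrt_eq_rpow, ← Real.rpow_natCast, ← Real.rpow_mul h0.le, ← Real.rpow_neg h0.le,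
      ← Real.rpow_add h0]
    congr 1
    push_cast [Nat.cast_sub hn]
    ring
  have e2 : (1 - t) ^ ((1 : ℝ) / 2 - 1) = (√(1 - t))⁻¹ := by
    rw [Real.sqrt_eq_rpow, ← Real.rpow_neg (by linarith)]
    norm_num
  rw [e1, e2, Real.sq_sqrt h0.le]
  have := Real.sqrt_pos.2 h0
  have := Real.sqrt_pos.2 (sub_pos.2 h1)
  field_simp

/-- This is the substitution t = sin² s. The derivative is taken only on the open interval, since
the integrand can be singular at both ends. -/
theorem integral_beta_eq {n : ℕ} (hn : 2 ≤ n) {x : ℝ} (hx : x ∈ Icc (0 : ℝ) 1) :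
    ∫ t in (0 : ℝ)..x, t ^ (((n : ℝ) - 1) / 2 - 1) * (1 - t) ^ ((1 : ℝ) / 2 - 1) =
      2 * sinPowInt (n - 2) (Real.arcsin √x) := by
  have hd : ∀ t ∈ Ioo 0 x, HasDerivAt (fun t => 2 * sinPowInt (n - 2) (Real.arcsin √t))
      (t ^ (((n : ℝ) - 1) / 2 - 1) * (1 - t) ^ ((1 : ℝ) / 2 - 1)) t := by
    intro t ht
    have ht1 : t < 1 := ht.2.trans_le hx.2
    rw [betaIntegrand_eq hn ht.1 ht1]
    have hs1 : √t < 1 := by rw [Real.sqrt_lt' one_pos]; simpa using ht1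
    have hs0 : 0 < √t := Real.sqrt_pos.2 ht.1
    have h1 := (Real.hasDerivAt_arcsin (by linarith : √t ≠ -1) hs1.ne).comp t
      (Real.hasDerivAt_sqrt ht.1.ne')
    have h2 := ((hasDerivAt_sinPowInt (n - 2) (Real.arcsin √t)).comp t h1).const_mul 2
    rwa [Real.sin_arcsin (by linarith) hs1.le] at h2
  have hc : ContinuousOn (fun t => 2 * sinPowInt (n - 2) (Real.arcsin √t)) (Icc 0 x) := by
    have := continuous_sinPowInt (n - 2)
    have := Real.continuous_arcsin
    fun_prop
  have hnn : ∀ t ∈ Ioo 0 x,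
      0 ≤ t ^ (((n : ℝ) - 1) / 2 - 1) * (1 - t) ^ ((1 : ℝ) / 2 - 1) := fun t ht =>
    mul_nonneg (Real.rpow_nonneg ht.1.le _)
      (Real.rpow_nonneg (sub_nonneg.2 (ht.2.le.trans hx.2)) _)
  rw [intervalIntegral.integral_eq_sub_of_hasDerivAt_of_le hx.1 hc hd]
  · simp
  -- A nonnegative derivative of a continuous function is integrable, whatever its endpoint
  -- singularities.
  · apply intervalIntegral.intervalIntegrable_deriv_of_nonneg (g := fun t => 2 * sinPowInt (n - 2) (Real.arcsin √t))
    · rwa [uIcc_of_le hx.1]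
    · simpa [hx.1] using hd
    · simpa [hx.1] using hnn

theorem regIncBeta_eq {n : ℕ} (hn : 2 ≤ n) {x : ℝ} (hx : x ∈ Icc (0 : ℝ) 1) :
    regIncBeta x (((n : ℝ) - 1) / 2) (1 / 2) =
      sinPowInt (n - 2) (Real.arcsin √x) / sinPowInt (n - 2) (Real.pi / 2) := by
  rw [regIncBeta, integral_beta_eq hn hx, integral_beta_eq hn ⟨zero_le_one, le_rfl⟩, Real.sqrt_one,
    Real.arcsin_one, mul_div_mul_left _ _ two_ne_zero]

theorem regIncBeta_sin_sq {n : ℕ} (hn : 2 ≤ n) {θ : ℝ} (h0 : 0 ≤ θ) (h1 : θ ≤ Real.pi / 2) :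
    regIncBeta (Real.sin θ ^ 2) (((n : ℝ) - 1) / 2) (1 / 2) =
      sinPowInt (n - 2) θ / sinPowInt (n - 2) (Real.pi / 2) := by
  rw [regIncBeta_eq hn ⟨sq_nonneg _, Real.sin_sq_le_one θ⟩, Real.sqrt_sq
    (Real.sin_nonneg_of_nonneg_of_le_pi h0 (by linarith [Real.pi_pos])),
    Real.arcsin_sin (by linarith) h1]

/-- The normalized measure of a spherical cap of angle `θ`, see `capMeasure_le_sphereUniform`. -/
noncomputable def capMeasure (n : ℕ) (θ : ℝ) : ℝ :=
  sinPowInt (n - 2) θ / (2 * sinPowInt (n - 2) (Real.pi / 2))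

theorem regIncBeta_eq_two_mul_capMeasure {n : ℕ} (hn : 2 ≤ n) {θ : ℝ} (h0 : 0 ≤ θ)
    (h1 : θ ≤ Real.pi / 2) :
    regIncBeta (Real.sin θ ^ 2) (((n : ℝ) - 1) / 2) (1 / 2) = 2 * capMeasure n θ := by
  have := sinPowInt_pos (n - 2) (half_pos Real.pi_pos) (by linarith [Real.pi_pos])
  rw [regIncBeta_sin_sq hn h0 h1, capMeasure]
  field_simp

theorem strictMonoOn_capMeasure (n : ℕ) : StrictMonoOn (capMeasure n) (Icc 0 Real.pi) := by
  intro a ha b hb hab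
  have := sinPowInt_pos (n - 2) (half_pos Real.pi_pos) (by linarith [Real.pi_pos])
  exact div_lt_div_of_pos_right (strictMonoOn_sinPowInt (n - 2) ha hb hab) (by positivity)

@[simp]
theorem capMeasure_zero (n : ℕ) : capMeasure n 0 = 0 := by simp [capMeasure]

theorem capMeasure_pi_div_two (n : ℕ) : capMeasure n (Real.pi / 2) = 1 / 2 := by
  have := sinPowInt_pos (n - 2) (half_pos Real.pi_pos) (by linarith [Real.pi_pos])
  rw [capMeasure]
  field_simp

theorem continuous_capMeasure (n : ℕ) : Continuous (capMeasure n) :=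
  (continuous_sinPowInt _).div_const _

/-- The angle `θ ∈ [0, π/2]` of a cap of measure `ε`. -/
theorem capTheta_capMeasure {n : ℕ} (hn : 2 ≤ n) {θ : ℝ} (h0 : 0 ≤ θ) (h1 : θ ≤ Real.pi / 2) :
    capTheta n (capMeasure n θ) = θ ∧ capDelta n (capMeasure n θ) = Real.cos θ := by
  have key : regIncBetaInv (2 * capMeasure n θ) (((n : ℝ) - 1) / 2) (1 / 2) = Real.sin θ ^ 2 := by
    -- By injectivity, the choice made by `invFunOn` can only be sin² θ.
    have hinj : InjOn (fun x => regIncBeta x (((n : ℝ) - 1) / 2) (1 / 2)) (Icc 0 1) := by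
      intro x hx y hy hxy
      have hpos := sinPowInt_pos (n - 2) (half_pos Real.pi_pos) (by linarith [Real.pi_pos])
      simp only [regIncBeta_eq hn hx, regIncBeta_eq hn hy] at hxy
      have hmem : ∀ z ∈ Icc (0 : ℝ) 1, Real.arcsin √z ∈ Icc 0 Real.pi := fun z _ =>
        ⟨Real.arcsin_nonneg.2 (Real.sqrt_nonneg _), (Real.arcsin_le_pi_div_two _).trans
          (by linarith [Real.pi_pos])⟩
      have h2 := (strictMonoOn_sinPowInt (n - 2)).injOn (hmem x hx) (hmem y hy)
        ((div_left_inj' hpos.ne').1 hxy)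
      have hI : ∀ z ∈ Icc (0 : ℝ) 1, √z ∈ Icc (-1 : ℝ) 1 := fun z hz =>
        ⟨by linarith [Real.sqrt_nonneg z], Real.sqrt_le_one.2 hz.2⟩
      exact (Real.sqrt_inj hx.1 hy.1).1 (Real.injOn_arcsin (hI x hx) (hI y hy) h2)
    have hs : Real.sin θ ^ 2 ∈ Icc (0 : ℝ) 1 := ⟨sq_nonneg _, Real.sin_sq_le_one θ⟩
    rw [← regIncBeta_eq_two_mul_capMeasure hn h0 h1, regIncBetaInv]
    exact hinj.leftInvOn_invFunOn hs
  have hδ : capDelta n (capMeasure n θ) = Real.cos θ := by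
    rw [capDelta, key, ← Real.cos_sq', Real.sqrt_sq
      (Real.cos_nonneg_of_mem_Icc ⟨by linarith [Real.pi_pos], h1⟩)]
  exact ⟨by rw [capTheta, hδ, Real.arccos_cos h0 (by linarith [Real.pi_pos])], hδ⟩

theorem capTheta_spec {n : ℕ} (hn : 2 ≤ n) {ε : ℝ} (hε : ε ∈ Ioo (0 : ℝ) (1 / 2)) :
    0 < capTheta n ε ∧ capTheta n ε < Real.pi / 2 ∧ capMeasure n (capTheta n ε) = ε := by
  have hp := Real.pi_pos
  obtain ⟨θ, hθ, rfl⟩ : ε ∈ capMeasure n '' Ioo 0 (Real.pi / 2) := by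
    apply intermediate_value_Ioo (by positivity) (continuous_capMeasure n).continuousOn
    simpa [capMeasure_pi_div_two] using hε
  rw [(capTheta_capMeasure hn hθ.1.le hθ.2.le).1]
  exact ⟨hθ.1, hθ.2, rfl⟩

theorem capTheta_doubledMeasure {n : ℕ} (hn : 2 ≤ n) {ε : ℝ} (hε : ε ∈ Ioo (0 : ℝ) (1 / 2))
    (hθ : 2 * capTheta n ε < Real.pi / 2) :
    capTheta n (doubledMeasure n ε) = 2 * capTheta n ε ∧
      capDelta n (doubledMeasure n ε) = Real.cos (2 * capTheta n ε) := by
  have h := (capTheta_spec hn hε).1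
  have e : doubledMeasure n ε = capMeasure n (2 * capTheta n ε) := by
    rw [doubledMeasure, regIncBeta_eq_two_mul_capMeasure hn (by positivity) hθ.le]
    ring
  rw [e]
  exact capTheta_capMeasure hn (by positivity) hθ.le

theorem failureBound_eq {n : ℕ} (hn : 2 ≤ n) (M N : ℕ) {ε : ℝ} (hε : ε ∈ Ioo (0 : ℝ) (1 / 2)) :
    failureBound n M N ε = M * (1 - ε / M) ^ N / capMeasure n (capTheta n ε / 2) := by
  have h := capTheta_spec hn hε
  rw [failureBound, regIncBeta_eq_two_mul_capMeasure hn (by linarith) (by linarith), mul_assoc,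
    mul_div_mul_left _ _ two_ne_zero]

/-! ### The measure of a spherical cap -/

/-- The part of the unit ball in the cone of angle `θ` around the unit vector `u`. -/
def coneBall {n : ℕ} (u : Euc n) (θ : ℝ) : Set (Euc n) :=
  {x | ‖x‖ < 1 ∧ Real.cos θ * ‖x‖ ≤ inner ℝ u x}

/-- The antiderivative `F` comes from integration by parts; at r = sin θ its two algebraic terms
cancel. -/
theorem integral_cone_profile (k : ℕ) {θ : ℝ} (h0 : 0 < θ) (h1 : θ ≤ Real.pi / 2) :
    ∫ r in (0 : ℝ)..Real.sin θ, r ^ k * (√(1 - r ^ 2) - Real.cos θ / Real.sin θ * r) =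
      sinPowInt k θ / (k + 2) := by
  have hp := Real.pi_pos
  have hs0 : 0 < Real.sin θ := Real.sin_pos_of_pos_of_lt_pi h0 (by linarith)
  have hs1 : Real.sin θ ≤ 1 := Real.sin_le_one θ
  set c := Real.cos θ / Real.sin θ with hc
  set F : ℝ → ℝ := fun r => (sinPowInt k (Real.arcsin r) + r ^ (k + 1) * √(1 - r ^ 2) -
    c * r ^ (k + 2)) / (k + 2) with hF
  have hd : ∀ r ∈ Ioo 0 (Real.sin θ), HasDerivAt F (r ^ k * (√(1 - r ^ 2) - c * r)) r := by
    intro r hr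
    have hr1 : r < 1 := hr.2.trans_le hs1
    have hpos : 0 < 1 - r ^ 2 := by nlinarith [hr.1]
    have hsq : 0 < √(1 - r ^ 2) := Real.sqrt_pos.2 hpos
    have d1 := (hasDerivAt_sinPowInt k (Real.arcsin r)).comp r
      (Real.hasDerivAt_arcsin (by linarith [hr.1]) hr1.ne)
    rw [Real.sin_arcsin (by linarith [hr.1]) hr1.le] at d1
    have d2 : HasDerivAt (fun r : ℝ => √(1 - r ^ 2)) (-(2 * r) / (2 * √(1 - r ^ 2))) r := by
      have := ((hasDerivAt_pow 2 r).const_sub 1).sqrt hpos.ne'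
      simpa using this
    have d3 := (hasDerivAt_pow (k + 1) r).mul d2
    have d4 := (hasDerivAt_pow (k + 2) r).const_mul c
    have d5 := ((d1.add d3).sub d4).div_const ((k : ℝ) + 2)
    refine HasDerivAt.congr_deriv d5 ?_
    have e : √(1 - r ^ 2) ^ 2 = 1 - r ^ 2 := Real.sq_sqrt hpos.le
    simp only [Nat.add_sub_cancel, show k + 2 - 1 = k + 1 by omega]
    push_cast
    rw [div_eq_iff (by positivity)]
    field_simp
    ring_nf
    rw [show √(1 - r ^ 2) ^ 2 = 1 - r ^ 2 from e]
    ring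
  have hcont : ContinuousOn F (Icc 0 (Real.sin θ)) := by
    have := continuous_sinPowInt k
    have := Real.continuous_arcsin
    exact Continuous.continuousOn (by fun_prop)
  rw [intervalIntegral.integral_eq_sub_of_hasDerivAt_of_le hs0.le hcont hd
    (Continuous.intervalIntegrable (by fun_prop) _ _)]
  have e : √(1 - Real.sin θ ^ 2) = Real.cos θ := by
    rw [← Real.cos_sq', Real.sqrt_sq (Real.cos_nonneg_of_mem_Icc ⟨by linarith, h1⟩)]
  simp only [hF, Real.arcsin_sin (by linarith) h1, e, hc, Real.arcsin_zero, sinPowInt_zero]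
  field_simp
  ring

theorem measurableSet_coneProd (k : ℕ) (c : ℝ) :
    MeasurableSet {q : Euc (k + 1) × ℝ | c * ‖q.1‖ ≤ q.2 ∧ ‖q.1‖ ^ 2 + q.2 ^ 2 < 1} := by
  have h1 : MeasurableSet {q : Euc (k + 1) × ℝ | c * ‖q.1‖ ≤ q.2} :=
    measurableSet_le (by fun_prop) (by fun_prop)
  have h2 : MeasurableSet {q : Euc (k + 1) × ℝ | ‖q.1‖ ^ 2 + q.2 ^ 2 < 1} :=
    measurableSet_lt (by fun_prop) (by fun_prop)
  exact h1.inter h2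

/-- In cylindrical coordinates, the fibre over y with ‖y‖ = r is an interval of length √(1 - r²) - r
cot θ, which is empty for r > sin θ. Polar integration in y reduces the volume to
`integral_cone_profile`. -/
theorem volume_real_cone_prod (k : ℕ) {θ : ℝ} (h0 : 0 < θ) (h1 : θ ≤ Real.pi / 2) :
    (volume : Measure (Euc (k + 1) × ℝ)).real
      {q | Real.cos θ / Real.sin θ * ‖q.1‖ ≤ q.2 ∧ ‖q.1‖ ^ 2 + q.2 ^ 2 < 1} =
    (k + 1) * (volume : Measure (Euc (k + 1))).real (Metric.ball 0 1) *
      (sinPowInt k θ / (k + 2)) := by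
  have hp := Real.pi_pos
  have hs0 : 0 < Real.sin θ := Real.sin_pos_of_pos_of_lt_pi h0 (by linarith)
  have hc0 : 0 ≤ Real.cos θ := Real.cos_nonneg_of_mem_Icc ⟨by linarith, h1⟩
  set c := Real.cos θ / Real.sin θ with hc
  have hcpos : 0 ≤ c := by positivity
  have hcs : c * Real.sin θ = Real.cos θ := by rw [hc]; field_simp
  set g : ℝ → ℝ := fun r => √(1 - r ^ 2) - c * r with hg
  have hmeas : MeasurableSet {q : Euc (k + 1) × ℝ | c * ‖q.1‖ ≤ q.2 ∧ ‖q.1‖ ^ 2 + q.2 ^ 2 < 1} :=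
    measurableSet_coneProd k c
  have hslice : ∀ y : Euc (k + 1), (volume : Measure ℝ) (Prod.mk y ⁻¹'
      {q : Euc (k + 1) × ℝ | c * ‖q.1‖ ≤ q.2 ∧ ‖q.1‖ ^ 2 + q.2 ^ 2 < 1}) =
      ENNReal.ofReal (max (g ‖y‖) 0) := by
    intro y
    have : Prod.mk y ⁻¹' {q : Euc (k + 1) × ℝ | c * ‖q.1‖ ≤ q.2 ∧ ‖q.1‖ ^ 2 + q.2 ^ 2 < 1} =
        Ico (c * ‖y‖) √(1 - ‖y‖ ^ 2) := by
      ext h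
      simp only [mem_preimage, mem_ofPred_eq, mem_Ico]
      refine and_congr_right fun hh => ?_
      rw [Real.lt_sqrt (le_trans (by positivity) hh)]
      constructor <;> intro _ <;> linarith
    rw [this, Real.volume_Ico, ENNReal.ofReal_max, ENNReal.ofReal_zero]
    simp [hg]
  rw [Measure.real, Measure.volume_eq_prod, Measure.prod_apply hmeas]
  simp_rw [hslice]
  rw [← integral_eq_lintegral_of_nonneg_ae (f := fun y => max (g ‖y‖) 0) (Eventually.of_forall fun _ => le_max_right _ _)
    (Continuous.aestronglyMeasurable (by fun_prop)),
    integral_fun_norm_addHaar volume (fun r => max (g r) 0), finrank_euclideanSpace_fin]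
  have hset : ∫ r in Ioi (0 : ℝ), r ^ (k + 1 - 1) • max (g r) 0 =
      ∫ r in Ioc (0 : ℝ) (Real.sin θ), r ^ k * g r := by
    rw [setIntegral_eq_of_subset_of_forall_sdiff_eq_zero measurableSet_Ioi
      (fun r hr => hr.1 : Ioc 0 (Real.sin θ) ⊆ Ioi 0)]
    · refine setIntegral_congr_fun measurableSet_Ioc fun r hr => ?_
      have : 0 ≤ g r := by
        have h1 : c * r ≤ Real.cos θ := by
          rw [← hcs]; exact mul_le_mul_of_nonneg_left hr.2 hcpos
        have h2 : Real.cos θ ≤ √(1 - r ^ 2) := by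
          refine Real.le_sqrt_of_sq_le ?_
          rw [Real.cos_sq']
          nlinarith [hr.1, hr.2]
        simp only [hg]; linarith
      simp [max_eq_left this]
    · rintro r ⟨hr0, hr1⟩
      have hr : Real.sin θ < r := by
        by_contra h; exact hr1 ⟨hr0, not_lt.1 h⟩
      have : g r ≤ 0 := by
        have h1 : Real.cos θ ≤ c * r := by
          rw [← hcs]; exact mul_le_mul_of_nonneg_left hr.le hcpos
        have h2 : √(1 - r ^ 2) ≤ Real.cos θ := by
          rw [Real.sqrt_le_left hc0, Real.cos_sq']
          nlinarith
        simp only [hg]; linarith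
      simp [max_eq_right this]
  rw [hset, ← intervalIntegral.integral_of_le hs0.le, integral_cone_profile k h0 h1]
  simp only [nsmul_eq_mul, smul_eq_mul]
  push_cast
  ring

/-- Any isometry, followed by the reflection exchanging the image of u with the axis vector. -/
theorem exists_isometry_prod {k : ℕ} {u : Euc (k + 2)} (hu : ‖u‖ = 1) :
    ∃ Φ : Euc (k + 2) ≃ₗᵢ[ℝ] WithLp 2 (Euc (k + 1) × ℝ), Φ u = WithLp.toLp 2 (0, 1) := by
  have hfr : Module.finrank ℝ (WithLp 2 (Euc (k + 1) × ℝ)) = k + 2 := by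
    rw [(WithLp.linearEquiv 2 ℝ (Euc (k + 1) × ℝ)).finrank_eq, Module.finrank_prod]
    simp
  set Ψ : Euc (k + 2) ≃ₗᵢ[ℝ] WithLp 2 (Euc (k + 1) × ℝ) :=
    ((stdOrthonormalBasis ℝ (WithLp 2 (Euc (k + 1) × ℝ))).reindex (finCongr hfr)).repr.symm
  refine ⟨Ψ.trans (Submodule.reflection (ℝ ∙ (Ψ u - WithLp.toLp 2 (0, 1)))ᗮ), ?_⟩
  rw [LinearIsometryEquiv.trans_apply]
  apply Submodule.reflection_sub
  rw [Ψ.norm_map, hu, WithLp.prod_norm_eq_of_L2]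
  simp

theorem volume_real_coneBall {k : ℕ} {u : Euc (k + 2)} (hu : ‖u‖ = 1) {θ : ℝ} (h0 : 0 < θ)
    (h1 : θ ≤ Real.pi / 2) :
    (volume : Measure (Euc (k + 2))).real (coneBall u θ) =
      (k + 1) * (volume : Measure (Euc (k + 1))).real (Metric.ball 0 1) *
        (sinPowInt k θ / (k + 2)) := by
  have hp := Real.pi_pos
  have hs0 : 0 < Real.sin θ := Real.sin_pos_of_pos_of_lt_pi h0 (by linarith)
  have hc0 : 0 ≤ Real.cos θ := Real.cos_nonneg_of_mem_Icc ⟨by linarith, h1⟩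
  obtain ⟨Φ, hΦ⟩ := exists_isometry_prod hu
  have hmp := (WithLp.volume_preserving_ofLp (Euc (k + 1)) ℝ).comp Φ.measurePreserving
  rw [← volume_real_cone_prod k h0 h1, Measure.real, Measure.real,
    ← hmp.measure_preimage (measurableSet_coneProd k _).nullMeasurableSet]
  congr 2
  ext x
  set q := Φ x with hq
  have hn : ‖x‖ ^ 2 = ‖q.fst‖ ^ 2 + q.snd ^ 2 := by
    rw [← Φ.norm_map x, WithLp.prod_norm_sq_eq_of_L2, Real.norm_eq_abs, sq_abs]
  have hi : inner ℝ u x = q.snd := by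
    rw [← Φ.inner_map_map, hΦ, WithLp.prod_inner_apply]
    simp [hq]
  simp only [coneBall, mem_ofPred_eq, mem_preimage, Function.comp_apply]
  change _ ↔ Real.cos θ / Real.sin θ * ‖q.fst‖ ≤ q.snd ∧ ‖q.fst‖ ^ 2 + q.snd ^ 2 < 1
  rw [hi, ← hn, and_comm]
  refine and_congr ?_ ?_
  · have hsc := Real.sin_sq_add_cos_sq θ
    rw [div_mul_eq_mul_div, div_le_iff₀ hs0]
    constructor
    · intro h
      have hq0 : 0 ≤ q.snd := le_trans (by positivity) h
      refine abs_le_of_sq_le_sq' ?_ (by positivity) |>.2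
      have h2 := pow_le_pow_left₀ (by positivity) h 2
      rw [mul_pow, hn] at h2
      rw [mul_pow, mul_pow]
      nlinarith
    · intro h
      have hq0 : 0 ≤ q.snd := by
        by_contra hneg
        have : 0 ≤ Real.cos θ * ‖q.fst‖ := by positivity
        nlinarith
      refine abs_le_of_sq_le_sq' ?_ hq0 |>.2
      have h2 := pow_le_pow_left₀ (by positivity) h 2
      rw [mul_pow, mul_pow] at h2
      rw [mul_pow, hn]
      nlinarith
  · rw [sq_lt_one_iff₀ (norm_nonneg x)]

/-- Two opposite half-balls cover the ball. An upper bound suffices, because the volume only serves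
as the denominator in a lower bound for caps. -/
theorem volume_real_ball_le {k : ℕ} :
    (volume : Measure (Euc (k + 2))).real (Metric.ball 0 1) ≤
      2 * ((k + 1) * (volume : Measure (Euc (k + 1))).real (Metric.ball 0 1) *
        (sinPowInt k (Real.pi / 2) / (k + 2))) := by
  have hp := Real.pi_pos
  obtain ⟨u, hu⟩ := exists_norm_eq (Euc (k + 2)) zero_le_one
  have hu' : ‖-u‖ = 1 := by rwa [norm_neg]
  have hsub : Metric.ball (0 : Euc (k + 2)) 1 ⊆
      coneBall u (Real.pi / 2) ∪ coneBall (-u) (Real.pi / 2) := by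
    intro x hx
    rw [mem_ball_zero_iff] at hx
    rcases le_total 0 (inner ℝ u x) with h | h
    · left; exact ⟨hx, by simpa using h⟩
    · right; exact ⟨hx, by simpa using h⟩
  have hfin : ∀ v : Euc (k + 2), volume (coneBall v (Real.pi / 2)) ≠ ⊤ := fun v =>
    ((measure_mono fun x hx => mem_ball_zero_iff.2 hx.1).trans_lt
      (measure_ball_lt_top (x := (0 : Euc (k + 2))) (r := 1))).ne
  have h := (measureReal_mono hsub (by finiteness [hfin u, hfin (-u)])).trans
    (measureReal_union_le (μ := (volume : Measure (Euc (k + 2)))) _ _)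
  rw [volume_real_coneBall hu (by positivity) le_rfl,
    volume_real_coneBall hu' (by positivity) le_rfl] at h
  linarith

/-! ### The uniform measure on the sphere -/

/-- The spherical cap of angle `θ` around `u`. -/
def sphereCap {n : ℕ} (u : Euc n) (θ : ℝ) : Set (USphere n) :=
  {x | Real.cos θ ≤ inner ℝ u (x : Euc n)}

theorem measurableSet_sphereCap {n : ℕ} (u : Euc n) (θ : ℝ) : MeasurableSet (sphereCap u θ) :=
  measurableSet_le measurable_const (Continuous.measurable (by fun_prop))

/-- `toSphere` is n times the volume of the truncated cone over s, and the factor n cancels in the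
normalization. -/
theorem sphereUniform_apply {n : ℕ} (hn : n ≠ 0) {s : Set (USphere n)} (hs : MeasurableSet s) :
    sphereUniform n s = (volume (Metric.ball (0 : Euc n) 1))⁻¹ *
      volume (Ioo (0 : ℝ) 1 • ((↑) '' s : Set (Euc n))) := by
  have h0 : (n : ENNReal) ≠ 0 := by exact_mod_cast hn
  rw [sphereUniform, Measure.smul_apply, Measure.toSphere_apply_univ, Measure.toSphere_apply' _ hs,
    finrank_euclideanSpace_fin, smul_eq_mul, ENNReal.mul_inv (Or.inl h0) (Or.inl (by finiteness)),
    mul_mul_mul_comm, ENNReal.inv_mul_cancel h0 (by finiteness), one_mul]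

theorem isProbabilityMeasure_sphereUniform {n : ℕ} (hn : n ≠ 0) :
    IsProbabilityMeasure (sphereUniform n) := by
  have : NeZero n := ⟨hn⟩
  have : Nontrivial (Euc n) := by
    have : Nonempty (Fin n) := ⟨⟨0, Nat.pos_of_ne_zero hn⟩⟩
    infer_instance
  refine ⟨?_⟩
  rw [sphereUniform, Measure.smul_apply, smul_eq_mul]
  refine ENNReal.inv_mul_cancel ?_ (by finiteness)
  rw [Ne, Measure.measure_univ_eq_zero]
  exact Measure.toSphere_ne_zero _

theorem capMeasure_le_sphereUniform {n : ℕ} (hn : 2 ≤ n) {u : Euc n} (hu : ‖u‖ = 1) {θ : ℝ}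
    (h0 : 0 < θ) (h1 : θ ≤ Real.pi / 2) :
    capMeasure n θ ≤ (sphereUniform n).real (sphereCap u θ) := by
  obtain ⟨k, rfl⟩ : ∃ k, n = k + 2 := ⟨n - 2, by omega⟩
  have hp := Real.pi_pos
  have hsub : coneBall u θ ⊆ Ioo (0 : ℝ) 1 • ((↑) '' sphereCap u θ : Set (Euc (k + 2))) ∪ {0} := by
    rintro x ⟨hx1, hx2⟩
    by_cases hx : x = 0
    · right; exact hx
    left
    have hx0 : 0 < ‖x‖ := norm_pos_iff.2 hx
    have hmem : ‖x‖⁻¹ • x ∈ Metric.sphere (0 : Euc (k + 2)) 1 := by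
      simp [norm_smul, hx0.ne']
    refine Set.mem_smul.2 ⟨‖x‖, ⟨hx0, hx1⟩, ‖x‖⁻¹ • x, ⟨⟨_, hmem⟩, ?_, rfl⟩, ?_⟩
    · simp only [sphereCap, mem_ofPred_eq, real_inner_smul_right]
      rw [inv_mul_eq_div, le_div_iff₀ hx0]
      exact hx2
    · simp [smul_smul, hx0.ne']
  have hle : volume (coneBall u θ) ≤
      volume (Ioo (0 : ℝ) 1 • ((↑) '' sphereCap u θ : Set (Euc (k + 2)))) := by
    refine (measure_mono hsub).trans ((measure_union_le _ _).trans ?_)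
    simp
  have hball : (volume : Measure (Euc (k + 2))) (Metric.ball 0 1) ≠ 0 :=
    (Metric.measure_ball_pos _ _ one_pos).ne'
  have hballpos : 0 < (volume : Measure (Euc (k + 2))).real (Metric.ball 0 1) :=
    ENNReal.toReal_pos hball (by finiteness)
  have hκ : 0 < (volume : Measure (Euc (k + 1))).real (Metric.ball 0 1) :=
    ENNReal.toReal_pos (Metric.measure_ball_pos _ _ one_pos).ne' (by finiteness)
  have hS := sinPowInt_pos k (half_pos hp) (by linarith)
  have hSθ := sinPowInt_pos k h0 (by linarith)
  have := isProbabilityMeasure_sphereUniform (n := k + 2) (by omega)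
  have hE : (volume (Metric.ball (0 : Euc (k + 2)) 1))⁻¹ * volume (coneBall u θ) ≤
      sphereUniform (k + 2) (sphereCap u θ) := by
    rw [sphereUniform_apply (by omega) (measurableSet_sphereCap u θ)]
    gcongr
  have hR := ENNReal.toReal_mono (by finiteness) hE
  rw [ENNReal.toReal_mul, ENNReal.toReal_inv] at hR
  refine le_trans ?_ hR
  change _ ≤ ((volume : Measure (Euc (k + 2))).real (Metric.ball 0 1))⁻¹ *
    (volume : Measure (Euc (k + 2))).real (coneBall u θ)
  rw [volume_real_coneBall hu h0 h1, capMeasure, inv_mul_eq_div, Nat.add_sub_cancel,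
    div_le_div_iff₀ (by positivity) hballpos]
  have := mul_le_mul_of_nonneg_left (volume_real_ball_le (k := k)) hSθ.le
  refine this.trans_eq ?_
  ring

/-- The action of a linear isometry on the sphere. -/
noncomputable def sphereMap {n : ℕ} (Φ : Euc n ≃ₗᵢ[ℝ] Euc n) (x : USphere n) : USphere n :=
  ⟨Φ x, by simp⟩

/-- A linear isometry preserves volume and commutes with forming the truncated cone over a set. -/
theorem measurePreserving_sphereMap {n : ℕ} (hn : n ≠ 0) (Φ : Euc n ≃ₗᵢ[ℝ] Euc n) :
    MeasurePreserving (sphereMap Φ) (sphereUniform n) (sphereUniform n) := by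
  have hm : Measurable (sphereMap Φ) :=
    Measurable.subtype_mk (Φ.continuous.measurable.comp measurable_subtype_coe)
  refine ⟨hm, ?_⟩
  ext s hs
  rw [Measure.map_apply hm hs, sphereUniform_apply hn hs, sphereUniform_apply hn (hm hs),
    ← Φ.measurePreserving.measure_preimage_emb Φ.toHomeomorph.measurableEmbedding
      (Ioo (0 : ℝ) 1 • ((↑) '' s : Set (Euc n)))]
  congr 2
  ext x
  simp only [mem_preimage, Set.mem_smul, mem_image]
  constructor
  · rintro ⟨r, hr, _, ⟨y, hy, rfl⟩, rfl⟩
    exact ⟨r, hr, _, ⟨_, hy, rfl⟩, by simp [sphereMap]⟩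
  · rintro ⟨r, hr, _, ⟨y, hy, rfl⟩, hx⟩
    refine ⟨r, hr, _, ⟨sphereMap Φ.symm y, ?_, rfl⟩, ?_⟩
    · have : sphereMap Φ (sphereMap Φ.symm y) = y := by ext; simp [sphereMap]
      rwa [this]
    · apply Φ.injective
      rw [← hx]
      simp [sphereMap]

/-! ### Wendel's recursion -/

/-- The Wendel numbers: `wendelBound p N d` bounds the probability that `N` independent random
vectors, each relevant with probability `p`, leave the relevant ones in an open half-space of a
`d`-dimensional space. -/
noncomputable def wendelBound (p : ℝ) : ℕ → ℕ → ℝ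
  | N, 0 => (1 - p) ^ N
  | 0, _ + 1 => 1
  | N + 1, d + 1 => (1 - p / 2) * wendelBound p N (d + 1) + p / 2 * wendelBound p N d

theorem wendelBound_nonneg {p : ℝ} (h0 : 0 ≤ p) (h1 : p ≤ 1) (N d : ℕ) :
    0 ≤ wendelBound p N d := by
  induction N generalizing d with
  | zero => cases d <;> simp [wendelBound]
  | succ N ih =>
    cases d with
    | zero => exact pow_nonneg (by linarith) _
    | succ d =>
      have := ih (d + 1)
      have := ih d
      have : 0 ≤ 1 - p / 2 := by linarith
      simp only [wendelBound]
      positivity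

/-- Both sides obey the same recursion in N, with the same initial value. -/
theorem wendelBound_one_le {p : ℝ} (h1 : p ≤ 1) (N : ℕ) :
    wendelBound p N 1 ≤ 2 * (1 - p / 2) ^ N - (1 - p) ^ N := by
  induction N with
  | zero => norm_num [wendelBound]
  | succ N ih =>
    simp only [wendelBound]
    have := mul_le_mul_of_nonneg_left ih (by linarith : 0 ≤ 1 - p / 2)
    rw [pow_succ, pow_succ]
    linarith

/-- For every z, z^(-d) (1 - p(1-z)/2)^N solves the recursion exactly, so only the boundary cases d
= 0 and N = 0 have to be compared. The parameter z trades the prefactor against the decay rate. -/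
theorem wendelBound_succ_le {p z : ℝ} (h0 : 0 ≤ p) (h1 : p ≤ 1) (hz : 0 < z) (hz1 : z ≤ 1)
    (N d : ℕ) :
    wendelBound p N (d + 1) ≤ 2 / (1 + z) * z⁻¹ ^ d * (1 - p * (1 - z) / 2) ^ N := by
  have hzi : 1 ≤ z⁻¹ := (one_le_inv₀ hz).2 hz1
  have hK : 1 ≤ 2 / (1 + z) := by rw [le_div_iff₀ (by linarith)]; linarith
  induction d generalizing N with
  | zero =>
    refine (wendelBound_one_le h1 N).trans ?_
    -- Convexity of x ↦ x^N: 1 - p/2 is the mean of 1 - p(1-z)/2 and 1 - p with weights 1/(1+z) and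
    -- z/(1+z).
    have hconv : (1 - p / 2) ^ N ≤
        1 / (1 + z) * (1 - p * (1 - z) / 2) ^ N + z / (1 + z) * (1 - p) ^ N := by
      have hx : (1 - p * (1 - z) / 2) ∈ Ici (0 : ℝ) := by
        simp only [mem_Ici]; nlinarith
      have hy : (1 - p) ∈ Ici (0 : ℝ) := by simp only [mem_Ici]; linarith
      have := (convexOn_pow (𝕜 := ℝ) N).2 hx hy (by positivity : 0 ≤ 1 / (1 + z))
        (by positivity : 0 ≤ z / (1 + z)) (by field_simp)
      simp only [smul_eq_mul] at this
      have e : 1 - p / 2 = 1 / (1 + z) * (1 - p * (1 - z) / 2) + z / (1 + z) * (1 - p) := by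
        field_simp
        ring
      rwa [e]
    have h2 : 2 * (z / (1 + z)) ≤ 1 := by
      rw [← mul_div_assoc, div_le_one (by linarith)]; linarith
    have h3 : 0 ≤ (1 - p) ^ N := pow_nonneg (by linarith) _
    have e : 2 / (1 + z) = 2 * (1 / (1 + z)) := by ring
    rw [pow_zero, mul_one, e]
    nlinarith
  | succ d ihd =>
    induction N with
    | zero =>
      simp only [wendelBound, pow_zero, mul_one]
      exact one_le_mul_of_one_le_of_one_le hK (one_le_pow₀ hzi)
    | succ N ihN =>
      simp only [wendelBound]
      have hp2 : 0 ≤ 1 - p / 2 := by linarith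
      calc _ ≤ (1 - p / 2) * (2 / (1 + z) * z⁻¹ ^ (d + 1) * (1 - p * (1 - z) / 2) ^ N) +
            p / 2 * (2 / (1 + z) * z⁻¹ ^ d * (1 - p * (1 - z) / 2) ^ N) := by
              gcongr
              exact ihd N
        _ = _ := by
          rw [pow_succ, pow_succ]
          field_simp
          ring

section Wendel

variable {Ω E : Type*} [NormedAddCommGroup E] [InnerProductSpace ℝ E]

/-- The event that the relevant vectors among `t (ω i)` lie in an open half-space with inner normal
in `-V`. -/
def halfSpaceEvent (C : Set Ω) (t : Ω → E) (V : Submodule ℝ E) (N : ℕ) : Set (Fin N → Ω) :=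
  {ω | ∃ e ∈ V, ∀ i, ω i ∈ C → inner ℝ e (t (ω i)) < 0}

/-- The slice of `halfSpaceEvent` at a given first sample. -/
def halfSpaceSlice (C : Set Ω) (t : Ω → E) (V : Submodule ℝ E) (N : ℕ) (x : Ω) :
    Set (Fin N → Ω) :=
  {ω | ∃ e ∈ V, (x ∈ C → inner ℝ e (t x) < 0) ∧ ∀ i, ω i ∈ C → inner ℝ e (t (ω i)) < 0}

theorem halfSpaceSlice_of_notMem {C : Set Ω} (t : Ω → E) (V : Submodule ℝ E) (N : ℕ) {x : Ω}
    (hx : x ∉ C) : halfSpaceSlice C t V N x = halfSpaceEvent C t V N := by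
  simp [halfSpaceSlice, halfSpaceEvent, hx]

/-- The strict inequalities are open in e, so a countable dense set of normals suffices. This yields
measurability. -/
theorem halfSpaceEvent_eq_iUnion [FiniteDimensional ℝ E] (C : Set Ω) (t : Ω → E) (V : Submodule ℝ E) (N : ℕ) :
    ∃ D : Set V, D.Countable ∧ halfSpaceEvent C t V N =
      ⋃ e ∈ D, {ω | ∀ i, ω i ∈ C → inner ℝ (e : E) (t (ω i)) < 0} := by
  obtain ⟨D, hDc, hDd⟩ := TopologicalSpace.exists_countable_dense V
  refine ⟨D, hDc, ?_⟩
  ext ω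
  simp only [halfSpaceEvent, mem_ofPred_eq, mem_iUnion, exists_prop]
  constructor
  · rintro ⟨e, he, h⟩
    have ho : IsOpen {e : V | ∀ i, ω i ∈ C → inner ℝ (e : E) (t (ω i)) < 0} := by
      simp only [ofPred_forall]
      refine isOpen_iInter_of_finite fun i => isOpen_iInter_of_finite fun _ => ?_
      exact isOpen_lt (by fun_prop) continuous_const
    obtain ⟨e', h1, h2⟩ := hDd.inter_open_nonempty _ ho ⟨⟨e, he⟩, h⟩
    exact ⟨e', h2, h1⟩
  · rintro ⟨e, _, h⟩
    exact ⟨e, e.2, h⟩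

variable [MeasurableSpace Ω]

theorem halfSpaceEvent_succ (C : Set Ω) (t : Ω → E) (V : Submodule ℝ E) (N : ℕ) :
    halfSpaceEvent C t V (N + 1) = MeasurableEquiv.piFinSuccAbove (fun _ => Ω) 0 ⁻¹'
      {q | q.2 ∈ halfSpaceSlice C t V N q.1} := by
  ext ω
  simp [halfSpaceEvent, halfSpaceSlice, Fin.forall_fin_succ, MeasurableEquiv.piFinSuccAbove,
    Fin.insertNthEquiv]
  rfl

variable [FiniteDimensional ℝ E] [MeasurableSpace E] [BorelSpace E]

theorem measurableSet_halfSpaceEvent {C : Set Ω} (hC : MeasurableSet C) {t : Ω → E}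
    (ht : Measurable t) (V : Submodule ℝ E) (N : ℕ) :
    MeasurableSet (halfSpaceEvent C t V N) := by
  obtain ⟨D, hDc, h⟩ := halfSpaceEvent_eq_iUnion C t V N
  rw [h]
  refine MeasurableSet.biUnion hDc fun e _ => ?_
  simp only [ofPred_forall]
  refine MeasurableSet.iInter fun i => ?_
  have : {ω : Fin N → Ω | ω i ∈ C → inner ℝ (e : E) (t (ω i)) < 0} =
      (fun ω => ω i) ⁻¹' (Cᶜ ∪ {x | inner ℝ (e : E) (t x) < 0}) := by
    ext ω; simp [imp_iff_not_or]
  rw [this]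
  exact measurable_pi_apply i (hC.compl.union (measurableSet_lt (by fun_prop) measurable_const))

theorem measure_halfSpaceEvent_succ (μ : Measure Ω) [IsProbabilityMeasure μ] {C : Set Ω}
    (hC : MeasurableSet C) {t : Ω → E} (ht : Measurable t) (V : Submodule ℝ E) (N : ℕ) :
    Measurable (fun x => Measure.pi (fun _ : Fin N => μ) (halfSpaceSlice C t V N x)) ∧
    Measure.pi (fun _ : Fin (N + 1) => μ) (halfSpaceEvent C t V (N + 1)) =
      ∫⁻ x, Measure.pi (fun _ : Fin N => μ) (halfSpaceSlice C t V N x) ∂μ := by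
  have hm := measurePreserving_piFinSuccAbove (fun _ : Fin (N + 1) => μ) 0
  have hS : MeasurableSet {q : Ω × (Fin N → Ω) | q.2 ∈ halfSpaceSlice C t V N q.1} := by
    have := measurableSet_halfSpaceEvent hC ht V (N + 1)
    rw [halfSpaceEvent_succ] at this
    exact (MeasurableEquiv.measurableSet_preimage _).1 this
  refine ⟨measurable_measure_prodMk_left hS, ?_⟩
  rw [halfSpaceEvent_succ, hm.measure_preimage_equiv, Measure.prod_apply hS]
  rfl


/-- Condition on the first sample x. An irrelevant x imposes nothing; on `C`, invariance under `T`
allows averaging the slices at x and T x. -/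
theorem measureReal_halfSpaceEvent_succ_le (μ : Measure Ω) [IsProbabilityMeasure μ] {C : Set Ω}
    (hC : MeasurableSet C) {t : Ω → E} (ht : Measurable t) {T : Ω → Ω}
    (hT : MeasurePreserving T μ μ) (hTC : ∀ x, T x ∈ C ↔ x ∈ C) (V : Submodule ℝ E) (N : ℕ)
    {γ : ℝ} (hγ : 0 ≤ γ)
    (h : ∀ x ∈ C, Measure.pi (fun _ : Fin N => μ) (halfSpaceSlice C t V N x) +
      Measure.pi (fun _ : Fin N => μ) (halfSpaceSlice C t V N (T x)) ≤ ENNReal.ofReal γ) :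
    (Measure.pi (fun _ : Fin (N + 1) => μ)).real (halfSpaceEvent C t V (N + 1)) ≤
      (1 - μ.real C) * (Measure.pi (fun _ : Fin N => μ)).real (halfSpaceEvent C t V N) +
        μ.real C / 2 * γ := by
  obtain ⟨hm, he⟩ := measure_halfSpaceEvent_succ μ hC ht V N
  set f := fun x => Measure.pi (fun _ : Fin N => μ) (halfSpaceSlice C t V N x) with hf
  set φ := Measure.pi (fun _ : Fin N => μ) (halfSpaceEvent C t V N) with hφ
  have h1 : ∫⁻ x in Cᶜ, f x ∂μ = φ * μ Cᶜ := by
    rw [setLIntegral_congr_fun hC.compl (g := fun _ => φ), setLIntegral_const]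
    intro x hx
    simp only [hf, halfSpaceSlice_of_notMem t V N hx, hφ]
  have hpre : T ⁻¹' C = C := by ext x; exact hTC x
  have h2 : ∫⁻ x in C, f (T x) ∂μ = ∫⁻ x in C, f x ∂μ := by
    have := hT.setLIntegral_comp_preimage hC hm
    rwa [hpre] at this
  have h3 : 2 * ∫⁻ x in C, f x ∂μ ≤ ENNReal.ofReal γ * μ C := by
    calc 2 * ∫⁻ x in C, f x ∂μ = ∫⁻ x in C, (f x + f (T x)) ∂μ := by
          rw [lintegral_add_left hm, h2, two_mul]
      _ ≤ ∫⁻ _ in C, ENNReal.ofReal γ ∂μ := setLIntegral_mono' hC h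
      _ = _ := setLIntegral_const _ _
  have h4 : 2 * Measure.pi (fun _ : Fin (N + 1) => μ) (halfSpaceEvent C t V (N + 1)) ≤
      ENNReal.ofReal γ * μ C + 2 * (φ * μ Cᶜ) := by
    rw [he, ← lintegral_add_compl _ hC, mul_add, h1]
    gcongr
  have h5 := ENNReal.toReal_mono (by finiteness) h4
  rw [ENNReal.toReal_add (by finiteness) (by finiteness)] at h5
  simp only [ENNReal.toReal_mul, ENNReal.toReal_ofReal hγ, ENNReal.toReal_ofNat] at h5
  have h6 : (μ Cᶜ).toReal = 1 - μ.real C := probReal_compl_eq_one_sub hC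
  rw [h6] at h5
  simp only [Measure.real] at h5 ⊢
  linarith

/-- **Wendel's bound.** Let `T` preserve `μ` and the relevance set `C`, and let it flip the
component in `U` of every relevant vector. Then `wendelBound` bounds the probability that the
relevant vectors among `N` independent ones lie in an open half-space with normal in `V ≤ U`. -/
theorem measureReal_halfSpaceEvent_le (μ : Measure Ω) [IsProbabilityMeasure μ] {C : Set Ω}
    (hC : MeasurableSet C) {t : Ω → E} (ht : Measurable t) {T : Ω → Ω}
    (hT : MeasurePreserving T μ μ) (hTC : ∀ x, T x ∈ C ↔ x ∈ C) {U : Submodule ℝ E}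
    (hflip : ∀ x ∈ C, ∀ e ∈ U, inner ℝ e (t (T x)) = -inner ℝ e (t x)) (N : ℕ)
    (V : Submodule ℝ E) (hV : V ≤ U) :
    (Measure.pi (fun _ : Fin N => μ)).real (halfSpaceEvent C t V N) ≤
      wendelBound (μ.real C) N (Module.finrank ℝ V) := by
  have hp0 : 0 ≤ μ.real C := measureReal_nonneg
  have hp1 : μ.real C ≤ 1 := measureReal_le_one
  induction N generalizing V with
  | zero =>
    have : wendelBound (μ.real C) 0 (Module.finrank ℝ V) = 1 := by
      cases Module.finrank ℝ V <;> simp [wendelBound]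
    rw [this]
    exact measureReal_le_one
  | succ N ih =>
    -- A relevant vector orthogonal to `V` cannot have negative product with a normal in `V`. In
    -- dimension 0 this means that no sample may be relevant.
    have hempty : ∀ y ∈ C, (∀ e ∈ V, inner ℝ e (t y) = 0) → halfSpaceSlice C t V N y = ∅ := by
      intro y hy h0
      ext ω
      simp only [halfSpaceSlice, mem_ofPred_eq, mem_empty_iff_false, iff_false]
      rintro ⟨e, he, h, -⟩
      have := h hy
      rw [h0 e he] at this
      exact lt_irrefl _ this
    have hempty' : ∀ x ∈ C, (∀ e ∈ V, inner ℝ e (t x) = 0) →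
        Measure.pi (fun _ : Fin N => μ) (halfSpaceSlice C t V N x) +
          Measure.pi (fun _ : Fin N => μ) (halfSpaceSlice C t V N (T x)) = 0 := by
      intro x hx h0
      rw [hempty x hx h0, hempty (T x) ((hTC x).2 hx)]
      · simp
      · intro e he
        rw [hflip x hx e (hV he), h0 e he, neg_zero]
    rcases hd : Module.finrank ℝ V with _ | d
    · have hV0 : V = ⊥ := Submodule.finrank_eq_zero.1 hd
      have h := measureReal_halfSpaceEvent_succ_le μ hC ht hT hTC V N le_rfl (fun x hx => by
        rw [hempty' x hx]
        · simp
        · intro e he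
          rw [hV0, Submodule.mem_bot] at he
          simp [he])
      have h2 := ih V hV
      rw [hd] at h2
      simp only [wendelBound] at h2 ⊢
      rw [pow_succ]
      nlinarith
    · have hb := wendelBound_nonneg hp0 hp1 N d
      set φ := (Measure.pi (fun _ : Fin N => μ)).real (halfSpaceEvent C t V N) with hφ
      have hφ0 : 0 ≤ φ := measureReal_nonneg
      have h := measureReal_halfSpaceEvent_succ_le μ hC ht hT hTC V N (add_nonneg hφ0 hb)
        (fun x hx => by
        by_cases h0 : ∀ e ∈ V, inner ℝ e (t x) = 0
        · rw [hempty' x hx h0]; exact zero_le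
        set f : V →ₗ[ℝ] ℝ := (innerₛₗ ℝ (t x)).comp V.subtype with hf
        have hf0 : f ≠ 0 := by
          contrapose! h0
          intro e he
          have := congrArg (fun g : V →ₗ[ℝ] ℝ => g ⟨e, he⟩) h0
          simpa [hf, real_inner_comm] using this
        set W : Submodule ℝ E := (LinearMap.ker f).map V.subtype with hW
        have hWd : Module.finrank ℝ W = d := by
          have := Module.Dual.finrank_ker_add_one_of_ne_zero hf0
          rw [hd] at this
          rw [hW, Submodule.finrank_map_subtype_eq]
          omega
        have hWV : W ≤ V := Submodule.map_subtype_le _ _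
        have hu : halfSpaceSlice C t V N x ∪ halfSpaceSlice C t V N (T x) ⊆
            halfSpaceEvent C t V N := by
          rintro ω (⟨e, he, -, h⟩ | ⟨e, he, -, h⟩) <;> exact ⟨e, he, h⟩
        -- Here a < 0 < a', so a' e - a e' is a positive combination of two admissible normals, and
        -- it is orthogonal to t x. The dimension thus drops by one.
        have hi : halfSpaceSlice C t V N x ∩ halfSpaceSlice C t V N (T x) ⊆
            halfSpaceEvent C t W N := by
          rintro ω ⟨⟨e, he, h1, h2⟩, e', he', h1', h2'⟩
          have h1 := h1 hx
          have h1' := h1' ((hTC x).2 hx)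
          rw [hflip x hx e' (hV he')] at h1'
          set a := inner ℝ e (t x)
          set a' := inner ℝ e' (t x) with ha'
          refine ⟨a' • e - a • e', ?_, fun i hi => ?_⟩
          · refine ⟨⟨a' • e - a • e', V.sub_mem (V.smul_mem _ he) (V.smul_mem _ he')⟩, ?_, rfl⟩
            have e1 : inner ℝ (t x) e = a := real_inner_comm _ _
            have e2 : inner ℝ (t x) e' = a' := real_inner_comm _ _
            simp [hf, inner_sub_right, inner_smul_right, e1, e2, mul_comm]
          · have h2 := h2 i hi
            have h2' := h2' i hi
            rw [inner_sub_left, real_inner_smul_left, real_inner_smul_left]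
            nlinarith
        have hm : MeasurableSet (halfSpaceSlice C t V N (T x)) := by
          have hS : MeasurableSet {q : Ω × (Fin N → Ω) | q.2 ∈ halfSpaceSlice C t V N q.1} := by
            have := measurableSet_halfSpaceEvent hC ht V (N + 1)
            rw [halfSpaceEvent_succ] at this
            exact (MeasurableEquiv.measurableSet_preimage _).1 this
          exact measurable_prodMk_left hS
        -- The sum of the two slices is the measure of their union plus that of their intersection;
        -- these give the two terms of Wendel's recursion.
        rw [← measure_union_add_inter _ hm, ENNReal.ofReal_add hφ0 hb]
        gcongr
        · rw [hφ, ofReal_measureReal]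
          exact measure_mono hu
        · refine (measure_mono hi).trans ?_
          rw [ENNReal.le_ofReal_iff_toReal_le (by finiteness) hb, ← hWd]
          exact ih W (hWV.trans hV))
      have h2 := ih V hV
      rw [hd] at h2
      simp only [wendelBound]
      nlinarith

end Wendel

/-! ### Comparison of caps of different angles -/

/-- The integral of a power of the sine, in the variable `1 - cos`. -/
theorem sinPowInt_succ_eq (k : ℕ) {θ : ℝ} (h0 : 0 ≤ θ) (h1 : θ ≤ Real.pi) :
    sinPowInt (k + 1) θ = ∫ t in (0 : ℝ)..(1 - Real.cos θ), √(t * (2 - t)) ^ k := by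
  have h := intervalIntegral.integral_comp_mul_deriv (a := 0) (b := θ)
    (f := fun x => 1 - Real.cos x) (f' := Real.sin) (g := fun t => √(t * (2 - t)) ^ k)
    (fun x _ => by simpa using (Real.hasDerivAt_cos x).const_sub 1) (by fun_prop) (by fun_prop)
  simp only [Real.cos_zero, sub_self] at h
  rw [← h, sinPowInt]
  refine intervalIntegral.integral_congr fun x hx => ?_
  rw [uIcc_of_le h0] at hx
  have : (1 - Real.cos x) * (2 - (1 - Real.cos x)) = Real.sin x ^ 2 := by
    rw [Real.sin_sq]; ring
  simp only [Function.comp_apply, this]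
  rw [Real.sqrt_sq (Real.sin_nonneg_of_nonneg_of_le_pi hx.1 (hx.2.trans h1)), pow_succ]

/-- Rescale t to ρ t and compare integrands pointwise by the factor a. Since a ≤ ρ, the pointwise
inequality is tightest at t = T, which is hypothesis `h`. -/
theorem le_integral_sqrt_pow (k : ℕ) {ρ a T T' : ℝ} (hρ : 0 ≤ ρ) (ha : 0 ≤ a) (hT : 0 ≤ T)
    (hT2 : T ≤ 2) (hTT : ρ * T ≤ T') (haρ : a ≤ ρ)
    (h : a ^ 2 * (2 - T) ≤ ρ * (2 - ρ * T)) :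
    ρ * a ^ k * ∫ t in (0 : ℝ)..T, √(t * (2 - t)) ^ k ≤
      ∫ t in (0 : ℝ)..T', √(t * (2 - t)) ^ k := by
  have hcont : Continuous fun t : ℝ => √(t * (2 - t)) ^ k := by fun_prop
  calc ρ * a ^ k * ∫ t in (0 : ℝ)..T, √(t * (2 - t)) ^ k
      = ρ * ∫ t in (0 : ℝ)..T, a ^ k * √(t * (2 - t)) ^ k := by
        rw [intervalIntegral.integral_const_mul]; ring
    _ ≤ ρ * ∫ t in (0 : ℝ)..T, √(ρ * t * (2 - ρ * t)) ^ k := by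
        refine mul_le_mul_of_nonneg_left ?_ hρ
        refine intervalIntegral.integral_mono_on hT
          (Continuous.intervalIntegrable (by fun_prop) _ _)
          (Continuous.intervalIntegrable (by fun_prop) _ _) fun t ht => ?_
        rw [← mul_pow]
        refine pow_le_pow_left₀ (by positivity) ?_ k
        refine Real.le_sqrt_of_sq_le ?_
        rw [mul_pow, Real.sq_sqrt (mul_nonneg ht.1 (by linarith [ht.2]))]
        have h1 : ρ * t ≤ ρ * T := mul_le_mul_of_nonneg_left ht.2 hρ
        have h2 : a ^ 2 * (2 - t) ≤ ρ * (2 - ρ * t) := by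
          have : 0 ≤ (T - t) * (ρ ^ 2 - a ^ 2) :=
            mul_nonneg (sub_nonneg.2 ht.2) (sub_nonneg.2 (pow_le_pow_left₀ ha haρ 2))
          nlinarith
        have := mul_le_mul_of_nonneg_left h2 ht.1
        linarith
    _ = ∫ t in (0 : ℝ)..(ρ * T), √(t * (2 - t)) ^ k := by
        have := intervalIntegral.smul_integral_comp_mul_left (fun t => √(t * (2 - t)) ^ k) ρ
          (a := 0) (b := T)
        simpa using this
    _ ≤ _ := by
        refine intervalIntegral.integral_mono_interval le_rfl (by positivity) hTT ?_
          (hcont.intervalIntegrable _ _)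
        exact Eventually.of_forall fun t => by positivity

/-- `le_integral_sqrt_pow` with ρ = 21/10 and a = 13/10. In terms of y = cos(θ/2), the two endpoints
are 1 - cos θ = 2(1 - y)(1 + y) and 1 - cos(3θ/2) = (1 - y)(2y + 1)². -/
theorem le_sinPowInt_three_halves (k : ℕ) {θ : ℝ} (h0 : 0 ≤ θ) (h1 : θ ≤ Real.pi / 4) :
    21 / 10 * (13 / 10) ^ k * sinPowInt (k + 1) θ ≤ sinPowInt (k + 1) (3 * θ / 2) := by
  have hp := Real.pi_pos
  rw [sinPowInt_succ_eq k h0 (by linarith), sinPowInt_succ_eq k (by linarith) (by linarith)]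
  have hs : (1414 / 1000 : ℝ) ≤ √2 := Real.le_sqrt_of_sq_le (by norm_num)
  have hc : 707 / 1000 ≤ Real.cos θ := by
    have := Real.cos_le_cos_of_nonneg_of_le_pi h0 (by linarith) h1
    rw [Real.cos_pi_div_four] at this
    linarith
  set y := Real.cos (θ / 2) with hy
  have e1 : Real.cos θ = 2 * y ^ 2 - 1 := by
    rw [hy, ← Real.cos_two_mul]; ring_nf
  have e2 : Real.cos (3 * θ / 2) = 4 * y ^ 3 - 3 * y := by
    rw [hy, ← Real.cos_three_mul]; ring_nf
  have hy0 : 0 ≤ y := Real.cos_nonneg_of_mem_Icc ⟨by linarith, by linarith⟩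
  have hy1 : y ≤ 1 := Real.cos_le_one _
  have hy2 : 923 / 1000 ≤ y := by nlinarith
  refine le_integral_sqrt_pow k (by norm_num) (by norm_num) (by linarith [Real.cos_le_one θ])
    (by linarith) ?_ (by norm_num) (by linarith)
  rw [e1, e2]
  have : 0 ≤ (1 - y) * ((2 * y + 1) ^ 2 - 21 / 5 * (1 + y)) := by
    apply mul_nonneg <;> nlinarith
  nlinarith

/-- `le_integral_sqrt_pow` with ρ = 13 and a = 1 compares the angles π/8 and π/2; a hemisphere has
measure 1/2, hence 1/26. -/
theorem capMeasure_half_le {n : ℕ} (hn : 3 ≤ n) {θ : ℝ} (h0 : 0 ≤ θ) (h1 : θ ≤ Real.pi / 4) :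
    capMeasure n (θ / 2) ≤ 1 / 26 := by
  obtain ⟨k, rfl⟩ : ∃ k, n = k + 3 := ⟨n - 3, by omega⟩
  have hp := Real.pi_pos
  have hmono := (strictMonoOn_capMeasure (k + 3)).monotoneOn (a := θ / 2) (b := Real.pi / 8)
    ⟨by linarith, by linarith⟩ ⟨by linarith, by linarith⟩ (by linarith)
  refine hmono.trans ?_
  have hS : 13 * 1 ^ k * sinPowInt (k + 1) (Real.pi / 8) ≤ sinPowInt (k + 1) (Real.pi / 2) := by
    rw [sinPowInt_succ_eq k (by linarith) (by linarith),
      sinPowInt_succ_eq k (by linarith) (by linarith), Real.cos_pi_div_two, Real.cos_pi_div_eight]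
    have h1 : (24 / 13 : ℝ) ≤ √(2 + √2) := by
      have : (1414 / 1000 : ℝ) ≤ √2 := Real.le_sqrt_of_sq_le (by norm_num)
      exact Real.le_sqrt_of_sq_le (by linarith)
    have h2 : √(2 + √2) ≤ 2 := by
      have : √2 ≤ 2 := by rw [Real.sqrt_le_left] <;> norm_num
      rw [Real.sqrt_le_left] <;> linarith
    exact le_integral_sqrt_pow k (by norm_num) (by norm_num) (by linarith) (by linarith)
      (by linarith) (by norm_num) (by linarith)
  have hpos := sinPowInt_pos (k + 1) (half_pos hp) (by linarith)
  rw [capMeasure, show k + 3 - 2 = k + 1 by omega, div_le_div_iff₀ (by positivity) (by norm_num)]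
  simp only [one_pow, mul_one] at hS
  linarith

theorem capMeasure_two (θ : ℝ) : capMeasure 2 θ = θ / Real.pi := by
  simp only [capMeasure, sinPowInt, Nat.sub_self, pow_zero, intervalIntegral.integral_const,
    sub_zero, smul_eq_mul, mul_one]
  ring_nf

/-- The parameters for which Wendel's bound beats the failure bound. -/
theorem exists_wendel_parameters {n : ℕ} (hn : 2 ≤ n) {θ : ℝ} (h0 : 0 < θ)
    (h1 : θ ≤ Real.pi / 4) :
    ∃ z c : ℝ, 0 < z ∧ z ≤ 1 ∧ 1 ≤ c ∧
      c * capMeasure n θ ≤ (1 - z) * capMeasure n (3 * θ / 2) ∧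
      2 / (1 + z) * z⁻¹ ^ (n - 2) * capMeasure n (θ / 2) ^ (c - 1) ≤ 1 := by
  have hp := Real.pi_pos
  have hm0 : 0 ≤ capMeasure n (θ / 2) := by
    have := (strictMonoOn_capMeasure n).monotoneOn (a := 0) (b := θ / 2) ⟨le_rfl, hp.le⟩
      ⟨by linarith, by linarith⟩ (by linarith)
    simpa using this
  obtain rfl | hn3 := hn.eq_or_lt
  -- On the circle caps are proportional to angles: 4/3 ≤ (9/10)(3/2), and (1/8)^(1/3) = 1/2 beats
  -- the prefactor 20/11.
  · refine ⟨1 / 10, 4 / 3, by norm_num, by norm_num, by norm_num, ?_, ?_⟩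
    · rw [capMeasure_two, capMeasure_two, mul_div_assoc', mul_div_assoc']
      refine div_le_div_of_nonneg_right ?_ hp.le
      linarith
    · have h : capMeasure 2 (θ / 2) ≤ 1 / 8 := by
        rw [capMeasure_two, div_le_iff₀ hp]; linarith
      have : capMeasure 2 (θ / 2) ^ ((4 : ℝ) / 3 - 1) ≤ 1 / 2 := by
        refine (Real.rpow_le_rpow hm0 h (by norm_num)).trans ?_
        rw [show (1 / 8 : ℝ) = (1 / 2) ^ (3 : ℝ) by norm_num, ← Real.rpow_mul (by norm_num)]
        norm_num
      norm_num at this ⊢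
      linarith
  · obtain ⟨k, rfl⟩ : ∃ k, n = k + 3 := ⟨n - 3, by omega⟩
    -- The exponent c grows linearly in k so that (1/26)^(c-1) can absorb the prefactor (5/3)
    -- 5^(k+1). The growth of the cap ratio, at least (21/10)(1 + 3k/10), leaves room for it.
    refine ⟨1 / 5, 5 / 3 + k / 2, by norm_num, by norm_num, ?_, ?_, ?_⟩
    · have : (0 : ℝ) ≤ k := k.cast_nonneg
      linarith
    · have h := le_sinPowInt_three_halves k h0.le h1
      have hb : 1 + (k : ℝ) * (3 / 10) ≤ (13 / 10) ^ k := by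
        have := one_add_mul_le_pow (show (-2 : ℝ) ≤ 3 / 10 by norm_num) k
        norm_num at this ⊢
        exact this
      have hS := sinPowInt_pos (k + 1) h0 (by linarith)
      have hpos := sinPowInt_pos (k + 1) (half_pos hp) (by linarith)
      simp only [capMeasure, show k + 3 - 2 = k + 1 by omega]
      rw [mul_div_assoc', mul_div_assoc']
      refine div_le_div_of_nonneg_right ?_ (by positivity)
      have : (5 / 3 + (k : ℝ) / 2) ≤ 4 / 5 * (21 / 10 * (13 / 10) ^ k) := by
        have : (0 : ℝ) ≤ k := k.cast_nonneg
        linarith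
      have := mul_le_mul_of_nonneg_right this hS.le
      linarith
    · have h26 := capMeasure_half_le (n := k + 3) (by omega) h0.le h1
      have hk : (0 : ℝ) ≤ k := k.cast_nonneg
      have e1 : (1 / 26 : ℝ) ^ ((2 : ℝ) / 3) ≤ 3 / 25 := by
        have : (1 / 26 : ℝ) ^ ((2 : ℝ) / 3) = ((1 / 26) ^ 2) ^ ((1 : ℝ) / 3) := by
          rw [← Real.rpow_natCast, ← Real.rpow_mul (by norm_num)]; norm_num
        rw [this, show (3 / 25 : ℝ) = ((3 / 25) ^ 3) ^ ((1 : ℝ) / 3) by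
          rw [← Real.rpow_natCast, ← Real.rpow_mul (by norm_num)]; norm_num]
        exact Real.rpow_le_rpow (by norm_num) (by norm_num) (by norm_num)
      have e2 : (1 / 26 : ℝ) ^ ((k : ℝ) / 2) ≤ (1 / 5) ^ k := by
        have : (1 / 5 : ℝ) ^ k = (1 / 25) ^ ((k : ℝ) / 2) := by
          rw [show (1 / 25 : ℝ) = (1 / 5) ^ (2 : ℝ) by norm_num, ← Real.rpow_mul (by norm_num),
            ← Real.rpow_natCast]
          congr 1
          ring
        rw [this]
        exact Real.rpow_le_rpow (by norm_num) (by norm_num) (by positivity)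
      have e3 : capMeasure (k + 3) (θ / 2) ^ ((5 : ℝ) / 3 + k / 2 - 1) ≤ 3 / 25 * (1 / 5) ^ k := by
        refine (Real.rpow_le_rpow hm0 h26 (by linarith)).trans ?_
        rw [show (5 : ℝ) / 3 + k / 2 - 1 = 2 / 3 + k / 2 by ring, Real.rpow_add (by norm_num)]
        gcongr
      calc _ ≤ 2 / (1 + 1 / 5) * (1 / 5 : ℝ)⁻¹ ^ (k + 1) * (3 / 25 * (1 / 5) ^ k) := by
            rw [show k + 3 - 2 = k + 1 by omega]
            gcongr
        _ = (5 : ℝ) ^ k * (1 / 5) ^ k := by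
            rw [pow_succ]; norm_num; ring
        _ = 1 := by rw [← mul_pow]; norm_num
        _ ≤ 1 := le_rfl

/-! ### Switched systems of joint spectral radius less than one -/

theorem act_mul {n : ℕ} (A B : Matrix (Fin n) (Fin n) ℝ) (x : Euc n) :
    act (A * B) x = act A (act B x) := by
  simp [act]

theorem act_one {n : ℕ} : act (1 : Matrix (Fin n) (Fin n) ℝ) = 1 := by
  simp [act]

theorem norm_act_list_prod_le {n : ℕ} {c : ℝ} (hc : 0 ≤ c) (l : List (Matrix (Fin n) (Fin n) ℝ))
    (h : ∀ B ∈ l, ‖act B‖ ≤ c) : ‖act l.prod‖ ≤ c ^ l.length := by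
  induction l with
  | nil =>
    rw [List.prod_nil, act_one, List.length_nil, pow_zero]
    exact ContinuousLinearMap.norm_id_le
  | cons B l ih =>
    have e : act (B :: l).prod = act B * act l.prod := by
      simp [act]
    rw [e, List.length_cons, pow_succ']
    exact (norm_mul_le _ _).trans (mul_le_mul (h B (by simp))
      (ih fun B' hB' => h B' (by simp [hB'])) (norm_nonneg _) hc)

/-- Beyond some length every product has norm below 1, and the shorter products are bounded by a
fixed power of `c`. -/
theorem exists_norm_act_switchProd_le {n M : ℕ} {A : Fin M → Matrix (Fin n) (Fin n) ℝ}
    (hA : jointSpectralRadius A < 1) :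
    ∃ C : ℝ, 0 < C ∧ ∀ (k : ℕ) (σ : Fin k → Fin M), ‖act (switchProd A σ)‖ ≤ C := by
  set c : ℝ := 1 + ∑ i, ‖act (A i)‖ with hc
  have hc1 : 1 ≤ c := by
    have : 0 ≤ ∑ i, ‖act (A i)‖ := Finset.sum_nonneg fun _ _ => norm_nonneg _
    linarith
  have hAc : ∀ i, ‖act (A i)‖ ≤ c := fun i => by
    have := Finset.single_le_sum (f := fun i => ‖act (A i)‖) (fun _ _ => norm_nonneg _)
      (Finset.mem_univ i)
    linarith
  have hpow : ∀ (k : ℕ) (σ : Fin k → Fin M), ‖act (switchProd A σ)‖ ≤ c ^ k := by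
    intro k σ
    have := norm_act_list_prod_le (by linarith) (List.ofFn fun i : Fin k => A (σ i.rev)) (c := c)
      (by
        intro B hB
        obtain ⟨i, rfl⟩ := (List.mem_ofFn' _ _).1 hB
        exact hAc _)
    simpa [switchProd] using this
  have hsup0 : ∀ k : ℕ, 0 ≤ ⨆ σ : Fin k → Fin M, ‖act (switchProd A σ)‖ := fun k =>
    Real.iSup_nonneg fun _ => norm_nonneg _
  have hbdd : IsBoundedUnder (· ≤ ·) atTop
      (fun k : ℕ => (⨆ σ : Fin k → Fin M, ‖act (switchProd A σ)‖) ^ (1 / (k : ℝ))) := by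
    refine isBoundedUnder_of ⟨c, fun k => ?_⟩
    rcases Nat.eq_zero_or_pos k with rfl | hk
    · simpa using hc1
    · have h1 : (⨆ σ : Fin k → Fin M, ‖act (switchProd A σ)‖) ≤ c ^ k :=
        Real.iSup_le (hpow k) (by positivity)
      refine (Real.rpow_le_rpow (hsup0 k) h1 (by positivity)).trans_eq ?_
      rw [one_div, Real.pow_rpow_inv_natCast (by linarith) hk.ne']
  have hev := eventually_lt_of_limsup_lt hA hbdd
  obtain ⟨k₀, hk₀⟩ := eventually_atTop.1 hev
  refine ⟨c ^ (k₀ + 1), by positivity, fun k σ => ?_⟩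
  rcases le_total k (k₀ + 1) with h | h
  · exact (hpow k σ).trans (pow_le_pow_right₀ hc1 h)
  · have h1 := hk₀ k (by omega)
    have h2 : (⨆ σ : Fin k → Fin M, ‖act (switchProd A σ)‖) < 1 := by
      by_contra hcon
      exact absurd h1 (not_lt.2 (Real.one_le_rpow (not_lt.1 hcon) (by positivity)))
    have h3 : ‖act (switchProd A σ)‖ ≤ ⨆ σ : Fin k → Fin M, ‖act (switchProd A σ)‖ :=
      le_ciSup (f := fun σ : Fin k → Fin M => ‖act (switchProd A σ)‖)
        (Set.finite_range _).bddAbove σ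
    exact (h3.trans h2.le).trans (one_le_pow₀ hc1)

theorem switchProd_cons {n M k : ℕ} (A : Fin M → Matrix (Fin n) (Fin n) ℝ) (τ : Fin M)
    (σ : Fin k → Fin M) :
    switchProd A (Fin.cons τ σ : Fin (k + 1) → Fin M) = switchProd A σ * A τ := by
  rw [switchProd, List.ofFn_succ', List.concat_eq_append, List.prod_append]
  simp [switchProd, Fin.rev_castSucc]

/-- A stable switched system has a bounded closed convex invariant set around any bounded set. -/
theorem exists_invariant_superset {n M : ℕ} {A : Fin M → Matrix (Fin n) (Fin n) ℝ}
    (hA : jointSpectralRadius A < 1) {X : Set (Euc n)} (hX : Bornology.IsBounded X) :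
    ∃ K : Set (Euc n), IsClosed K ∧ Convex ℝ K ∧ Bornology.IsBounded K ∧ X ⊆ K ∧
      ∀ σ, ∀ x ∈ K, act (A σ) x ∈ K := by
  obtain ⟨C, hC0, hC⟩ := exists_norm_act_switchProd_le hA
  obtain ⟨r, hr⟩ := hX.exists_norm_le
  have hKeq : {x | ∀ (k : ℕ) (σ : Fin k → Fin M), ‖act (switchProd A σ) x‖ ≤ C * r} =
      ⋂ (k : ℕ) (σ : Fin k → Fin M),
        act (switchProd A σ) ⁻¹' Metric.closedBall (0 : Euc n) (C * r) := by
    ext x; simp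
  refine ⟨{x | ∀ (k : ℕ) (σ : Fin k → Fin M), ‖act (switchProd A σ) x‖ ≤ C * r}, ?_, ?_, ?_, ?_, ?_⟩
  · rw [hKeq]
    exact isClosed_iInter fun k => isClosed_iInter fun σ =>
      Metric.isClosed_closedBall.preimage (act (switchProd A σ)).continuous
  · rw [hKeq]
    exact convex_iInter fun k => convex_iInter fun σ =>
      (convex_closedBall _ _).linear_preimage (act (switchProd A σ)).toLinearMap
  -- The empty product is among the constraints, so the set lies in a ball.
  · refine (Metric.isBounded_closedBall (x := (0 : Euc n)) (r := C * r)).subset fun x hx => ?_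
    have := hx 0 Fin.elim0
    simpa [switchProd, act_one] using this
  · intro x hx k σ
    exact ((act (switchProd A σ)).le_opNorm x).trans
      (mul_le_mul (hC k σ) (hr x hx) (norm_nonneg _) hC0.le)
  · intro τ x hx k σ
    have := hx (k + 1) (Fin.cons τ σ)
    rwa [switchProd_cons, act_mul] at this

/-! ### The limit set -/

theorem gauge_map_le {E : Type*} [AddCommGroup E] [Module ℝ E] {K : Set E} (hK : Absorbent ℝ K)
    (f : E →ₗ[ℝ] E) (hf : ∀ x ∈ K, f x ∈ K) (x : E) : gauge K (f x) ≤ gauge K x := by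
  have e : gauge K (f x) = gauge (f ⁻¹' K) x := by
    simp [gauge_def']
  rw [e]
  exact gauge_mono hK hf x

section Limit

variable {n M N : ℕ} {A : Fin M → Matrix (Fin n) (Fin n) ℝ} {X : Set (Euc n)}

theorem IsCPolytope.isBounded (hX : IsCPolytope X) : Bornology.IsBounded X := by
  obtain ⟨⟨t, rfl⟩, -⟩ := hX
  exact isBounded_convexHull.2 t.finite_toSet.isBounded

theorem convex_dataHull (hX : IsCPolytope X) (ω : Fin N → USphere n × Fin M) (k : ℕ) :
    Convex ℝ (dataHull A X ω k) := by
  cases k with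
  | zero =>
    obtain ⟨⟨t, rfl⟩, -⟩ := hX
    exact convex_convexHull ℝ _
  | succ k => exact convex_convexHull ℝ _

theorem dataHull_mem_nhds (hX : IsCPolytope X) (ω : Fin N → USphere n × Fin M) (k : ℕ) :
    dataHull A X ω k ∈ 𝓝 0 :=
  mem_of_superset (mem_interior_iff_mem_nhds.1 hX.2) (dataHull_mono A X ω k.zero_le)

/-- If R_k ⊆ K, then ‖A x‖_K ≤ ‖x‖_K ≤ ‖x‖_{R_k}, so each new point stays in K. This keeps the limit
bounded. -/
theorem dataHull_subset_of_invariant (hX : IsCPolytope X) (ω : Fin N → USphere n × Fin M)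
    {K : Set (Euc n)} (hKcl : IsClosed K) (hKc : Convex ℝ K) (hXK : X ⊆ K)
    (hKA : ∀ σ, ∀ x ∈ K, act (A σ) x ∈ K) (k : ℕ) : dataHull A X ω k ⊆ K := by
  have hK0 : K ∈ 𝓝 0 := mem_of_superset (mem_interior_iff_mem_nhds.1 hX.2) hXK
  induction k with
  | zero => exact hXK
  | succ k ih =>
    have key : ∀ (σ : Fin M) (x : Euc n), (gauge (dataHull A X ω k) x)⁻¹ • act (A σ) x ∈ K := by
      intro σ x
      rw [← hKcl.closure_eq, ← gauge_le_one_iff_mem_closure hKc hK0,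
        gauge_smul_of_nonneg (inv_nonneg.2 (gauge_nonneg _)), smul_eq_mul]
      refine (mul_le_mul_of_nonneg_left ((gauge_map_le (absorbent_nhds_zero hK0)
        (act (A σ)).toLinearMap (hKA σ) x).trans (gauge_mono
        (absorbent_nhds_zero (dataHull_mem_nhds hX ω k)) ih x))
        (inv_nonneg.2 (gauge_nonneg _))).trans ?_
      exact inv_mul_le_one
    refine convexHull_min (union_subset ih (union_subset ?_ ?_)) hKc
    · rintro y ⟨i, rfl⟩
      exact key _ _
    · rintro y ⟨i, rfl⟩
      rw [← map_neg]
      exact key _ _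

theorem convex_iUnion_dataHull (hX : IsCPolytope X) (ω : Fin N → USphere n × Fin M) :
    Convex ℝ (⋃ k, dataHull A X ω k) :=
  (dataHull_mono A X ω).directed_le.convex_iUnion fun {k} => convex_dataHull hX ω k

theorem convex_dataHullLimit (hX : IsCPolytope X) (ω : Fin N → USphere n × Fin M) :
    Convex ℝ (dataHullLimit A X ω) :=
  (convex_iUnion_dataHull hX ω).closure

theorem dataHull_subset_limit (ω : Fin N → USphere n × Fin M) (k : ℕ) :
    dataHull A X ω k ⊆ dataHullLimit A X ω :=
  (subset_iUnion _ k).trans subset_closure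

theorem dataHullLimit_mem_nhds (hX : IsCPolytope X) (ω : Fin N → USphere n × Fin M) :
    dataHullLimit A X ω ∈ 𝓝 0 :=
  mem_of_superset (dataHull_mem_nhds hX ω 0) (dataHull_subset_limit ω 0)

theorem isCompact_dataHullLimit (hA : jointSpectralRadius A < 1) (hX : IsCPolytope X)
    (ω : Fin N → USphere n × Fin M) : IsCompact (dataHullLimit A X ω) := by
  obtain ⟨K, hKcl, hKc, hKb, hXK, hKA⟩ := exists_invariant_superset hA hX.isBounded
  refine Metric.isCompact_of_isClosed_isBounded isClosed_closure (hKb.subset ?_)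
  exact closure_minimal
    (iUnion_subset (dataHull_subset_of_invariant hX ω hKcl hKc hXK hKA)) hKcl

/-- The sampled vectors of mode `σ`, together with their opposites. -/
def sampleVectors (ω : Fin N → USphere n × Fin M) (σ : Fin M) : Set (Euc n) :=
  {y | ∃ i, (ω i).2 = σ ∧ (y = (ω i).1 ∨ y = -((ω i).1 : Euc n))}

theorem finite_sampleVectors (ω : Fin N → USphere n × Fin M) (σ : Fin M) :
    (sampleVectors ω σ).Finite := by
  refine ((finite_range fun i => ((ω i).1 : Euc n)).union
    (finite_range fun i => -((ω i).1 : Euc n))).subset ?_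
  rintro y ⟨i, -, rfl | rfl⟩
  · left; exact ⟨i, rfl⟩
  · right; exact ⟨i, rfl⟩

theorem norm_of_mem_sampleVectors {ω : Fin N → USphere n × Fin M} {σ : Fin M} {y : Euc n}
    (hy : y ∈ sampleVectors ω σ) : ‖y‖ = 1 := by
  obtain ⟨i, -, rfl | rfl⟩ := hy <;> simp

/-- Each step k gives ‖A y‖_S ≤ ‖y‖_{R_k}; it remains to let k tend to infinity. -/
theorem gauge_act_le_of_mem_sampleVectors (hA : jointSpectralRadius A < 1) (hX : IsCPolytope X)
    {ω : Fin N → USphere n × Fin M} {σ : Fin M} {y : Euc n} (hy : y ∈ sampleVectors ω σ) :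
    gauge (dataHullLimit A X ω) (act (A σ) y) ≤ gauge (dataHullLimit A X ω) y := by
  set S := dataHullLimit A X ω with hS
  have hSc := convex_dataHullLimit (A := A) hX ω
  have hS0 := dataHullLimit_mem_nhds (A := A) hX ω
  have hmem : ∀ k, (gauge (dataHull A X ω k) y)⁻¹ • act (A σ) y ∈ dataHull A X ω (k + 1) := by
    intro k
    refine subset_convexHull ℝ _ (Or.inr ?_)
    obtain ⟨i, rfl, rfl | rfl⟩ := hy
    · exact Or.inl ⟨i, rfl⟩
    · exact Or.inr ⟨i, by rw [map_neg]⟩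
  have hstep : ∀ k, gauge S (act (A σ) y) ≤ gauge (dataHull A X ω k) y := by
    intro k
    have hpos : 0 < gauge (dataHull A X ω k) y := by
      refine (gauge_pos (absorbent_nhds_zero (dataHull_mem_nhds hX ω k)) ?_).2 ?_
      · exact NormedSpace.isVonNBounded_of_isBounded _
          ((isCompact_dataHullLimit hA hX ω).isBounded.subset (dataHull_subset_limit ω k))
      · rintro rfl
        simpa using norm_of_mem_sampleVectors hy
    have h1 := gauge_le_one_of_mem (dataHull_subset_limit ω (k + 1) (hmem k))
    rw [gauge_smul_of_nonneg (inv_nonneg.2 hpos.le), smul_eq_mul, inv_mul_le_one₀ hpos] at h1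
    exact h1
  -- For b > ‖y‖_S, the point y/b is interior to S. A convex set with nonempty interior has the same
  -- interior as its closure, so y/b already lies in some R_k.
  refine le_of_forall_gt_imp_ge_of_dense fun b hb => ?_
  have hb0 : 0 < b := (gauge_nonneg _).trans_lt hb
  have hint : b⁻¹ • y ∈ interior S := by
    rw [← gauge_lt_one_iff_mem_interior hSc hS0, gauge_smul_of_nonneg (inv_nonneg.2 hb0.le),
      smul_eq_mul, inv_mul_lt_one₀ hb0]
    exact hb
  have hU := convex_iUnion_dataHull (A := A) hX ω
  rw [hS, dataHullLimit, hU.interior_closure_eq_interior_of_nonempty_interior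
    ⟨0, mem_interior_iff_mem_nhds.2 (mem_of_superset (dataHull_mem_nhds hX ω 0)
      (subset_iUnion _ 0))⟩] at hint
  obtain ⟨k, hk⟩ := mem_iUnion.1 (interior_subset hint)
  refine (hstep k).trans (gauge_le_of_mem hb0.le ?_)
  exact (mem_smul_set_iff_inv_smul_mem₀ hb0.ne' _ _).2 hk

end Limit

/-! ### Contraction from a well-spread sample -/

/-- Either some nonnegative multiple of `v` lies in the convex hull of the finite set `Y`, or `Y`
lies in an open half-space whose complement contains `v`. -/
theorem exists_smul_mem_convexHull_or {E : Type*} [NormedAddCommGroup E] [InnerProductSpace ℝ E]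
    [CompleteSpace E] {Y : Set E} (hY : Y.Finite) {v : E}
    (hv : v ≠ 0) :
    (∃ t : ℝ, 0 ≤ t ∧ t • v ∈ convexHull ℝ Y) ∨
      ∃ e : E, 0 ≤ inner ℝ e v ∧ ∀ y ∈ Y, inner ℝ e y < 0 := by
  by_cases h : ∃ t : ℝ, 0 ≤ t ∧ t • v ∈ convexHull ℝ Y
  · exact Or.inl h
  right
  set L : Set E := (fun t : ℝ => t • v) '' Ici 0 with hL
  have hLc : Convex ℝ L :=
    (convex_Ici (0 : ℝ)).is_linear_image (IsLinearMap.isLinearMap_smul' v)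
  have hLcl : IsClosed L :=
    (isClosedEmbedding_smul_left hv).isClosedMap _ isClosed_Ici
  -- Separate the compact hull from the closed ray of v. The separating functional is nonnegative on
  -- v, since otherwise it would fall to `b` along the ray; it is negative on Y because b < 0.
  obtain ⟨f, a, b, h1, hab, h2⟩ := geometric_hahn_banach_compact_closed
    (convex_convexHull ℝ Y) (hY.isCompact_convexHull ℝ) hLc hLcl (by
      rw [Set.disjoint_left]
      rintro x hx ⟨t, ht, rfl⟩
      exact h ⟨t, ht, hx⟩)
  have hb : b < 0 := by simpa using h2 _ ⟨0, self_mem_Ici, rfl⟩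
  refine ⟨(InnerProductSpace.toDual ℝ E).symm f, ?_, fun y hy => ?_⟩
  · rw [InnerProductSpace.toDual_symm_apply]
    by_contra hneg
    rw [not_le] at hneg
    have := h2 _ ⟨b / f v, (div_pos_of_neg_of_neg hb hneg).le, rfl⟩
    rw [map_smul, smul_eq_mul, div_mul_cancel₀ _ hneg.ne] at this
    exact lt_irrefl _ this
  · rw [InnerProductSpace.toDual_symm_apply]
    linarith [h1 y (subset_convexHull ℝ _ hy)]

section Contraction

variable {n : ℕ} {S : Set (Euc n)}

/-- The boundary point on the ray of u shows that the infimum is over a nonempty set; over the empty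
set `sInf` would be 0. -/
theorem le_dMin (hSc : Convex ℝ S) {r : ℝ} (hr : 0 < r)
    (hball : Metric.ball 0 r ⊆ S) (hSb : Bornology.IsBounded S) {u : Euc n} (hu : u ≠ 0) (ε : ℝ) :
    r ≤ dMin u S ε := by
  have hS0 : S ∈ 𝓝 0 := mem_of_superset (Metric.ball_mem_nhds 0 hr) hball
  have hg : 0 < gauge S u := (gauge_pos (absorbent_nhds_zero hS0)
    (NormedSpace.isVonNBounded_of_isBounded _ hSb)).2 hu
  refine le_csInf ?_ ?_
  · refine Set.Nonempty.image _ ⟨(gauge S u)⁻¹ • u, ?_, ?_⟩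
    · rw [← gauge_eq_one_iff_mem_frontier hSc hS0, gauge_smul_of_nonneg (inv_nonneg.2 hg.le),
        smul_eq_mul, inv_mul_cancel₀ hg.ne']
    · simp only [dirCone, mem_ofPred_eq]
      rw [real_inner_smul_right, real_inner_self_eq_norm_sq, norm_smul, norm_inv, Real.norm_eq_abs,
        abs_of_pos hg, mul_assoc, mul_assoc, sq]
      refine mul_le_mul_of_nonneg_left ?_ (inv_nonneg.2 hg.le)
      refine mul_le_mul_of_nonneg_left ?_ (norm_nonneg _)
      exact mul_le_of_le_one_right (norm_nonneg _) (Real.cos_le_one _)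
  · rintro _ ⟨x, ⟨hx, -⟩, rfl⟩
    have h1 := mul_gauge_le_norm (x := x) hball
    rwa [(gauge_eq_one_iff_mem_frontier hSc hS0).2 hx, mul_one] at h1

theorem gauge_map_le_of_spread (hSc : Convex ℝ S) (hSb : Bornology.IsBounded S) (hS0 : S ∈ 𝓝 0)
    (B : Euc n →L[ℝ] Euc n) {Y : Set (Euc n)} (hYf : Y.Finite) (hY1 : ∀ y ∈ Y, ‖y‖ = 1)
    (hBY : ∀ y ∈ Y, gauge S (B y) ≤ gauge S y) {ε : ℝ} (hcos : 0 < Real.cos (capTheta n ε))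
    {u : Euc n} (hu : u ≠ 0)
    (hspread : ∀ e : Euc n, 0 ≤ inner ℝ e (‖u‖⁻¹ • u) →
      ∃ y ∈ Y, Real.cos (capTheta n ε) ≤ inner ℝ (‖u‖⁻¹ • u) y ∧ 0 ≤ inner ℝ e y) :
    gauge S (B u) ≤ ‖u‖ / (Real.cos (capTheta n ε) * dMin u S ε) := by
  obtain ⟨r, hr, hball⟩ := Metric.mem_nhds_iff.1 hS0
  have hd : 0 < dMin u S ε := hr.trans_le (le_dMin hSc hr hball hSb hu ε)
  have hu0 : 0 < ‖u‖ := norm_pos_iff.2 hu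
  set v : Euc n := ‖u‖⁻¹ • u with hv
  have hv1 : ‖v‖ = 1 := by rw [hv, norm_smul, norm_inv, norm_norm, inv_mul_cancel₀ hu0.ne']
  have huv : u = ‖u‖ • v := by rw [hv, smul_smul, mul_inv_cancel₀ hu0.ne', one_smul]
  set c := Real.cos (capTheta n ε) with hc
  -- The point y/‖y‖_S is on the boundary, inside the cone of u, and has norm 1/‖y‖_S, so it
  -- competes in `dMin`.
  have hgle : ∀ y ∈ Y, c ≤ inner ℝ v y → gauge S (B y) ≤ (dMin u S ε)⁻¹ := by
    intro y hy hcy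
    refine (hBY y hy).trans ?_
    have hg : 0 < gauge S y := (gauge_pos (absorbent_nhds_zero hS0)
      (NormedSpace.isVonNBounded_of_isBounded _ hSb)).2 (by
        rintro rfl; simpa using hY1 0 hy)
    rw [le_inv_comm₀ hg hd]
    have hnorm : ‖(gauge S y)⁻¹ • y‖ = (gauge S y)⁻¹ := by
      rw [norm_smul, hY1 y hy, mul_one, norm_inv, Real.norm_eq_abs, abs_of_pos hg]
    rw [← hnorm]
    refine csInf_le ⟨0, ?_⟩ ⟨_, ⟨?_, ?_⟩, rfl⟩
    · rintro _ ⟨x, -, rfl⟩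
      exact norm_nonneg x
    · rw [← gauge_eq_one_iff_mem_frontier hSc hS0, gauge_smul_of_nonneg (inv_nonneg.2 hg.le),
        smul_eq_mul, inv_mul_cancel₀ hg.ne']
    · simp only [dirCone, mem_ofPred_eq]
      rw [hnorm, real_inner_smul_right, mul_assoc]
      refine mul_le_mul_of_nonneg_left ?_ (inv_nonneg.2 hg.le)
      conv_rhs => rw [huv, real_inner_smul_left]
      exact mul_le_mul_of_nonneg_left hcy hu0.le
  rcases exists_smul_mem_convexHull_or (hYf.inter_of_left {y | c ≤ inner ℝ v y})
    (norm_ne_zero_iff.1 (by rw [hv1]; exact one_ne_zero) : v ≠ 0) with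
    ⟨t, -, ht⟩ | ⟨e, he, hneg⟩
  · have h1 : gauge S (B (t • v)) ≤ (dMin u S ε)⁻¹ := by
      have hconv : Convex ℝ {x | gauge S (B x) ≤ (dMin u S ε)⁻¹} :=
        (Convex.setOfPred_gauge_le hSc (mem_of_mem_nhds hS0) (absorbent_nhds_zero hS0)
          _).linear_preimage B.toLinearMap
      exact convexHull_min (fun y hy => hgle y hy.1 hy.2) hconv ht
    -- The half-space {c ≤ v·x} contains the nearby vectors, hence their hull, and v·(t v) = t.
    have h2 : c ≤ t := by
      have hconv : Convex ℝ {x : Euc n | c ≤ inner ℝ v x} :=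
        convex_halfSpace_ge (f := fun x => inner ℝ v x) (innerₛₗ ℝ v).isLinear c
      have := convexHull_min (inter_subset_right) hconv ht
      simp only [mem_ofPred_eq, real_inner_smul_right, real_inner_self_eq_norm_sq, hv1] at this
      simpa using this
    have ht0 : 0 < t := hcos.trans_le h2
    rw [map_smul, gauge_smul_of_nonneg ht0.le, smul_eq_mul] at h1
    have h3 : c * gauge S (B v) ≤ (dMin u S ε)⁻¹ :=
      (mul_le_mul_of_nonneg_right h2 (gauge_nonneg _)).trans h1
    have h4 : gauge S (B u) = ‖u‖ * gauge S (B v) := by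
      conv_lhs => rw [huv]
      rw [map_smul, gauge_smul_of_nonneg hu0.le, smul_eq_mul]
    rw [h4, div_eq_mul_inv]
    refine mul_le_mul_of_nonneg_left ?_ hu0.le
    rw [mul_inv, ← div_eq_inv_mul, le_div_iff₀ hcos, mul_comm]
    exact h3
  · obtain ⟨y, hy, hcy, hey⟩ := hspread e he
    exact absurd (hneg y ⟨hy, hcy⟩) (not_lt.2 hey)

theorem ne_zero_of_mem_extremePoints (hn : n ≠ 0) (hS0 : S ∈ 𝓝 0) {u : Euc n}
    (hu : u ∈ S.extremePoints ℝ) : u ≠ 0 := by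
  rintro rfl
  obtain ⟨r, hr, hball⟩ := Metric.mem_nhds_iff.1 hS0
  have : Nontrivial (Euc n) := by
    have : Nonempty (Fin n) := ⟨⟨0, Nat.pos_of_ne_zero hn⟩⟩
    infer_instance
  obtain ⟨x, hx⟩ := exists_norm_eq (Euc n) (half_pos hr).le
  have h1 : x ∈ S := hball (by rw [mem_ball_zero_iff, hx]; linarith)
  have h2 : -x ∈ S := hball (by rw [mem_ball_zero_iff, norm_neg, hx]; linarith)
  have h3 := (mem_extremePoints.1 hu).2 x h1 (-x) h2
    ⟨1 / 2, 1 / 2, by norm_num, by norm_num, by norm_num, by simp⟩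
  rw [h3.1, norm_zero] at hx
  linarith

/-- If the unit vectors of `Y` are well spread and `B` does not increase the gauge of `S` on `Y`,
then `B` maps `S` into a multiple of `S`. -/
theorem map_mem_smul_of_spread (hn : n ≠ 0) (hSc : Convex ℝ S) (hSk : IsCompact S)
    (hS0 : S ∈ 𝓝 0) (B : Euc n →L[ℝ] Euc n) {Y : Set (Euc n)} (hYf : Y.Finite)
    (hY1 : ∀ y ∈ Y, ‖y‖ = 1) (hBY : ∀ y ∈ Y, gauge S (B y) ≤ gauge S y) {ε : ℝ}
    (hδ : capDelta n ε = Real.cos (capTheta n ε)) (hcos : 0 < Real.cos (capTheta n ε))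
    (hspread : ∀ v e : Euc n, ‖v‖ = 1 → 0 ≤ inner ℝ e v →
      ∃ y ∈ Y, Real.cos (capTheta n ε) ≤ inner ℝ v y ∧ 0 ≤ inner ℝ e y) {x : Euc n} (hx : x ∈ S) :
    B x ∈ (1 / gammaLower S ε) • S := by
  obtain ⟨r, hr, hball⟩ := Metric.mem_nhds_iff.1 hS0
  obtain ⟨R, hR⟩ := hSk.isBounded.exists_norm_le
  have hne : (S.extremePoints ℝ).Nonempty := hSk.extremePoints_nonempty ⟨x, hx⟩
  have hu0 : ∀ u ∈ S.extremePoints ℝ, u ≠ 0 := fun u hu => ne_zero_of_mem_extremePoints hn hS0 hu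
  have hd : ∀ u ∈ S.extremePoints ℝ, r ≤ dMin u S ε := fun u hu =>
    le_dMin hSc hr hball hSk.isBounded (hu0 u hu) ε
  have hRpos : 0 < R := by
    obtain ⟨u, hu⟩ := hne
    exact (norm_pos_iff.2 (hu0 u hu)).trans_le (hR u hu.1)
  set c := Real.cos (capTheta n ε) with hc
  -- A uniform positive lower bound is needed: S is a limit and may have infinitely many extreme
  -- points.
  have hlow : ∀ a ∈ (fun u : Euc n => capDelta n ε * dMin u S ε / ‖u‖) '' (S.extremePoints ℝ),
      c * r / R ≤ a := by
    rintro _ ⟨u, hu, rfl⟩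
    simp only [hδ]
    have := norm_pos_iff.2 (hu0 u hu)
    have h1 := hd u hu
    have h2 := hR u hu.1
    exact div_le_div₀ (by nlinarith) (by gcongr) this h2
  have hγ : 0 < gammaLower S ε :=
    (by positivity : 0 < c * r / R).trans_le (le_csInf (hne.image _) hlow)
  have hext : ∀ u ∈ S.extremePoints ℝ, gauge S (B u) ≤ 1 / gammaLower S ε := by
    intro u hu
    have hun := norm_pos_iff.2 (hu0 u hu)
    have hdp := hr.trans_le (hd u hu)
    refine (gauge_map_le_of_spread hSc hSk.isBounded hS0 B hYf hY1 hBY hcos (hu0 u hu)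
      (fun e he => hspread _ e ?_ he)).trans ?_
    · rw [norm_smul, norm_inv, norm_norm, inv_mul_cancel₀ hun.ne']
    · have h1 : gammaLower S ε ≤ c * dMin u S ε / ‖u‖ := by
        rw [← hδ]
        exact csInf_le ⟨_, hlow⟩ ⟨u, hu, rfl⟩
      rw [← one_div_div]
      exact one_div_le_one_div_of_le hγ h1
  have hall : gauge S (B x) ≤ 1 / gammaLower S ε := by
    have hconv : Convex ℝ {x | gauge S (B x) ≤ 1 / gammaLower S ε} :=
      (Convex.setOfPred_gauge_le hSc (mem_of_mem_nhds hS0) (absorbent_nhds_zero hS0)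
        _).linear_preimage B.toLinearMap
    have hclosed : IsClosed {x | gauge S (B x) ≤ 1 / gammaLower S ε} :=
      isClosed_le ((continuous_gauge hSc hS0).comp B.continuous) continuous_const
    rw [← closure_convexHull_extremePoints hSk hSc] at hx
    exact closure_minimal (convexHull_min hext hconv) hclosed hx
  have hl : 0 < 1 / gammaLower S ε := by positivity
  have hcl : ∀ y, y ∈ S ↔ y ∈ closure S := fun y => by rw [hSk.isClosed.closure_eq]
  rw [mem_smul_set_iff_inv_smul_mem₀ hl.ne', hcl,
    ← gauge_le_one_iff_mem_closure hSc hS0, gauge_smul_of_nonneg (inv_nonneg.2 hl.le), smul_eq_mul,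
    inv_mul_le_one₀ hl]
  exact hall

end Contraction

/-! ### Directions not surrounded by the sample -/

section BadDirections

variable {n M N : ℕ}

/-- The directions `u` such that the sampled vectors of mode `σ` within angle `r` of `u` all lie in
an open half-space whose complement contains `u`. -/
def badDirections (ω : Fin N → USphere n × Fin M) (σ : Fin M) (r : ℝ) : Set (USphere n) :=
  {u | ∃ e : Euc n, 0 ≤ inner ℝ e (u : Euc n) ∧
    ∀ y ∈ sampleVectors ω σ, Real.cos r ≤ inner ℝ (u : Euc n) y → inner ℝ e y < 0}

theorem neg_mem_sampleVectors {ω : Fin N → USphere n × Fin M} {σ : Fin M} {y : Euc n}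
    (hy : y ∈ sampleVectors ω σ) : -y ∈ sampleVectors ω σ := by
  obtain ⟨i, hi, rfl | rfl⟩ := hy
  · exact ⟨i, hi, Or.inr rfl⟩
  · exact ⟨i, hi, Or.inl (neg_neg _)⟩

/-- Tilting e slightly towards u keeps the finitely many strict inequalities and makes e·u > 0
strict. All conditions are then open, and e can be moved into a dense set, which serves
measurability. -/
theorem exists_mem_dense_of_mem_badDirections {D : Set (Euc n)} (hD : Dense D)
    {ω : Fin N → USphere n × Fin M} {σ : Fin M} {r : ℝ} {u : USphere n}
    (hu : u ∈ badDirections ω σ r) :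
    ∃ e ∈ D, 0 < inner ℝ e (u : Euc n) ∧
      ∀ y ∈ sampleVectors ω σ, Real.cos r ≤ inner ℝ (u : Euc n) y → inner ℝ e y < 0 := by
  obtain ⟨e, he, h⟩ := hu
  set O : Set (Euc n) := ⋂ y ∈ sampleVectors ω σ ∩ {y | Real.cos r ≤ inner ℝ (u : Euc n) y},
    {e : Euc n | inner ℝ e y < 0} with hO
  have hOo : IsOpen O := ((finite_sampleVectors ω σ).inter_of_left _).isOpen_biInter fun y _ =>
    isOpen_lt (by fun_prop) continuous_const
  have heO : e ∈ O := by
    simp only [hO, mem_iInter]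
    exact fun y hy => h y hy.1 hy.2
  have hc : Tendsto (fun η : ℝ => e + η • (u : Euc n)) (𝓝[>] 0) (𝓝 e) := by
    have : Continuous fun η : ℝ => e + η • (u : Euc n) := by fun_prop
    have h1 := this.tendsto 0
    simp only [zero_smul, add_zero] at h1
    exact h1.mono_left nhdsWithin_le_nhds
  obtain ⟨η, hη, hη0⟩ := ((hc.eventually (hOo.mem_nhds heO)).and self_mem_nhdsWithin).exists
  have hpos : 0 < inner ℝ (e + η • (u : Euc n)) (u : Euc n) := by
    have h1 : ‖(u : Euc n)‖ = 1 := by simp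
    rw [inner_add_left, real_inner_smul_left, real_inner_self_eq_norm_sq, h1]
    have : (0 : ℝ) < η := hη0
    linarith
  obtain ⟨e', ⟨h1, h2⟩, h3⟩ := hD.inter_open_nonempty
    (O ∩ {e' : Euc n | 0 < inner ℝ e' (u : Euc n)})
    (hOo.inter (isOpen_lt continuous_const (by fun_prop))) ⟨_, hη, hpos⟩
  refine ⟨e', h3, h2, fun y hy hy' => ?_⟩
  simp only [hO, mem_iInter] at h1
  exact h1 y ⟨hy, hy'⟩

theorem measurableSet_badDirections (σ : Fin M) (r : ℝ) :
    MeasurableSet {q : (Fin N → USphere n × Fin M) × USphere n | q.2 ∈ badDirections q.1 σ r} := by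
  obtain ⟨D, hDc, hDd⟩ := TopologicalSpace.exists_countable_dense (Euc n)
  have hset : {q : (Fin N → USphere n × Fin M) × USphere n | q.2 ∈ badDirections q.1 σ r} =
      ⋃ e ∈ D, {q | 0 < inner ℝ e (q.2 : Euc n)} ∩ ⋂ i : Fin N,
        ({q | (q.1 i).2 = σ}ᶜ ∪
          (({q | Real.cos r ≤ inner ℝ (q.2 : Euc n) ((q.1 i).1 : Euc n)}ᶜ ∪
              {q | inner ℝ e ((q.1 i).1 : Euc n) < 0}) ∩
            ({q | Real.cos r ≤ inner ℝ (q.2 : Euc n) (-((q.1 i).1 : Euc n))}ᶜ ∪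
              {q | inner ℝ e (-((q.1 i).1 : Euc n)) < 0}))) := by
    ext ⟨ω, u⟩
    have key : ∀ e : Euc n, ((ω, u) ∈ {q : (Fin N → USphere n × Fin M) × USphere n |
        0 < inner ℝ e (q.2 : Euc n)} ∩ ⋂ i : Fin N,
        ({q | (q.1 i).2 = σ}ᶜ ∪
          (({q | Real.cos r ≤ inner ℝ (q.2 : Euc n) ((q.1 i).1 : Euc n)}ᶜ ∪
              {q | inner ℝ e ((q.1 i).1 : Euc n) < 0}) ∩
            ({q | Real.cos r ≤ inner ℝ (q.2 : Euc n) (-((q.1 i).1 : Euc n))}ᶜ ∪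
              {q | inner ℝ e (-((q.1 i).1 : Euc n)) < 0})))) ↔
        0 < inner ℝ e (u : Euc n) ∧ ∀ y ∈ sampleVectors ω σ,
          Real.cos r ≤ inner ℝ (u : Euc n) y → inner ℝ e y < 0 := by
      intro e
      simp only [mem_inter_iff, mem_iInter, mem_union, mem_compl_iff, mem_ofPred_eq,
        ← imp_iff_not_or]
      refine and_congr_right fun _ => ⟨?_, ?_⟩
      · rintro h y ⟨i, hi, rfl | rfl⟩
        · exact (h i hi).1
        · exact (h i hi).2
      · exact fun h i hi => ⟨h _ ⟨i, hi, Or.inl rfl⟩, h _ ⟨i, hi, Or.inr rfl⟩⟩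
    simp only [mem_iUnion, key, exists_prop]
    constructor
    · exact fun h => exists_mem_dense_of_mem_badDirections hDd h
    · rintro ⟨e, -, h1, h2⟩
      exact ⟨e, h1.le, h2⟩
  rw [hset]
  have hx : ∀ i : Fin N, Measurable fun q : (Fin N → USphere n × Fin M) × USphere n =>
      ((q.1 i).1 : Euc n) := fun i => by fun_prop
  have hu : Measurable fun q : (Fin N → USphere n × Fin M) × USphere n => (q.2 : Euc n) := by
    fun_prop
  refine MeasurableSet.biUnion hDc fun e _ => MeasurableSet.inter ?_ (MeasurableSet.iInter fun i =>
    MeasurableSet.union (MeasurableSet.compl ?_) (MeasurableSet.inter (MeasurableSet.union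
      (MeasurableSet.compl ?_) ?_) (MeasurableSet.union (MeasurableSet.compl ?_) ?_)))
  · exact measurableSet_lt measurable_const (measurable_const.inner hu)
  · have : Measurable fun q : (Fin N → USphere n × Fin M) × USphere n => (q.1 i).2 := by fun_prop
    exact this (measurableSet_singleton σ)
  · exact measurableSet_le measurable_const (hu.inner (hx i))
  · exact measurableSet_lt (measurable_const.inner (hx i)) measurable_const
  · exact measurableSet_le measurable_const (hu.inner (hx i).neg)
  · exact measurableSet_lt (measurable_const.inner (hx i).neg) measurable_const

theorem neg_mem_badDirections {ω : Fin N → USphere n × Fin M} {σ : Fin M} {r : ℝ}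
    {u v : USphere n} (huv : (v : Euc n) = -u) (hu : u ∈ badDirections ω σ r) :
    v ∈ badDirections ω σ r := by
  obtain ⟨e, he, h⟩ := hu
  refine ⟨-e, by rwa [huv, inner_neg_neg], fun y hy hyr => ?_⟩
  have := h (-y) (neg_mem_sampleVectors hy) (by rwa [inner_neg_right, ← inner_neg_left, ← huv])
  rwa [inner_neg_left, ← inner_neg_right]

theorem cos_add_le_inner {x y z : Euc n} (hx : ‖x‖ = 1) (hy : ‖y‖ = 1) (hz : ‖z‖ = 1) {a b : ℝ}
    (ha : 0 ≤ a) (hb : 0 ≤ b) (hab : a + b ≤ Real.pi) (h1 : Real.cos a ≤ inner ℝ x y)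
    (h2 : Real.cos b ≤ inner ℝ y z) : Real.cos (a + b) ≤ inner ℝ x z := by
  have key : ∀ {v w : Euc n}, ‖v‖ = 1 → ‖w‖ = 1 → ∀ {t : ℝ}, 0 ≤ t → t ≤ Real.pi →
      Real.cos t ≤ inner ℝ v w → InnerProductGeometry.angle v w ≤ t := by
    intro v w hv hw t ht0 ht1 h
    rw [InnerProductGeometry.angle, hv, hw, mul_one, div_one, ← Real.arccos_cos ht0 ht1]
    exact Real.arccos_le_arccos h
  have h3 := key hx hy ha (by linarith) h1
  have h4 := key hy hz hb (by linarith) h2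
  have h5 := InnerProductGeometry.angle_le_angle_add_angle x y z
  have h6 := Real.cos_le_cos_of_nonneg_of_le_pi (InnerProductGeometry.angle_nonneg x z) hab
    (h5.trans (add_le_add h3 h4))
  rwa [InnerProductGeometry.cos_angle, hx, hz, mul_one, div_one] at h6

/-- The reflection through the line spanned by a unit vector. -/
theorem inner_reflection_span {u : Euc n} (hu : ‖u‖ = 1) (e x : Euc n) :
    inner ℝ e ((ℝ ∙ u).reflection x) = 2 * inner ℝ u x * inner ℝ e u - inner ℝ e x := by
  rw [Submodule.reflection_singleton_apply, inner_sub_right, hu]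
  simp only [two_smul, inner_add_right, real_inner_smul_right]
  simp only [RCLike.ofReal_one, one_pow, div_one]
  ring

/-- One bad direction for the angle `a + b` yields a large set of bad directions for the angle
`b`. -/
theorem capMeasure_le_badDirections (hn : 2 ≤ n) {ω : Fin N → USphere n × Fin M} {σ : Fin M}
    {a b : ℝ} (ha : 0 < a) (hb : 0 < b) (hab : a + b ≤ Real.pi / 2) {v : USphere n}
    (hv : v ∈ badDirections ω σ (a + b)) :
    capMeasure n a ≤ (sphereUniform n).real (badDirections ω σ b) := by
  have hp := Real.pi_pos
  have := isProbabilityMeasure_sphereUniform (n := n) (by omega)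
  obtain ⟨e, he, h⟩ := hv
  have hv1 : ‖(v : Euc n)‖ = 1 := by simp
  have hcos : 0 < Real.cos a := Real.cos_pos_of_mem_Ioo ⟨by linarith, by linarith⟩
  -- The triangle inequality for angles makes every u in this half of the cap bad for b, with the
  -- same normal e.
  set D : Set (USphere n) := sphereCap (v : Euc n) a ∩ {u | 0 ≤ inner ℝ e (u : Euc n)} with hD
  have hDm : MeasurableSet D := (measurableSet_sphereCap _ _).inter
    (measurableSet_le measurable_const (Continuous.measurable (by fun_prop)))
  set R := sphereMap (ℝ ∙ (v : Euc n)).reflection with hR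
  set J := sphereMap (LinearIsometryEquiv.neg ℝ : Euc n ≃ₗᵢ[ℝ] Euc n) with hJ
  have hRp : MeasurePreserving R (sphereUniform n) (sphereUniform n) :=
    measurePreserving_sphereMap (by omega) _
  have hJp : MeasurePreserving J (sphereUniform n) (sphereUniform n) :=
    measurePreserving_sphereMap (by omega) _
  have hJv : ∀ u, (J u : Euc n) = -u := fun u => rfl
  have hDbad : D ⊆ badDirections ω σ b := by
    rintro u ⟨hu1, hu2⟩
    refine ⟨e, hu2, fun y hy hyb => h y hy ?_⟩
    exact cos_add_le_inner hv1 (by simp) (norm_of_mem_sampleVectors hy) ha.le hb.le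
      (by linarith) hu1 hyb
  have hJbad : J ⁻¹' D ⊆ badDirections ω σ b := fun u hu =>
    neg_mem_badDirections (by rw [hJv, neg_neg]) (hDbad hu)
  have hdisj : Disjoint D (J ⁻¹' D) := by
    rw [Set.disjoint_left]
    rintro u ⟨hu1, -⟩ ⟨hu2, -⟩
    simp only [sphereCap, mem_ofPred_eq, hJv, inner_neg_right] at hu1 hu2
    linarith
  -- The reflection through the line of v preserves the cap and, as e·v ≥ 0, sends points with e·u ≤
  -- 0 into D. So D has at least half the measure of the cap, and its antipode supplies the other
  -- half.
  have hcap : sphereCap (v : Euc n) a ⊆ D ∪ R ⁻¹' D := by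
    intro u hu
    rcases le_total 0 (inner ℝ e (u : Euc n)) with h0 | h0
    · exact Or.inl ⟨hu, h0⟩
    · have hu' : Real.cos a ≤ inner ℝ (v : Euc n) (u : Euc n) := hu
      refine Or.inr ⟨?_, ?_⟩
      · change Real.cos a ≤ inner ℝ (v : Euc n) ((ℝ ∙ (v : Euc n)).reflection u)
        rw [inner_reflection_span hv1, real_inner_self_eq_norm_sq, hv1]
        linarith
      · change 0 ≤ inner ℝ e ((ℝ ∙ (v : Euc n)).reflection u)
        rw [inner_reflection_span hv1]
        have : 0 ≤ inner ℝ (v : Euc n) (u : Euc n) := hcos.le.trans hu'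
        have := mul_nonneg this he
        linarith
  have e1 : (sphereUniform n).real (R ⁻¹' D) = (sphereUniform n).real D := by
    rw [Measure.real, Measure.real, hRp.measure_preimage hDm.nullMeasurableSet]
  have e2 : (sphereUniform n).real (J ⁻¹' D) = (sphereUniform n).real D := by
    rw [Measure.real, Measure.real, hJp.measure_preimage hDm.nullMeasurableSet]
  calc capMeasure n a ≤ (sphereUniform n).real (sphereCap (v : Euc n) a) :=
        capMeasure_le_sphereUniform hn hv1 ha (by linarith)
    _ ≤ (sphereUniform n).real (D ∪ R ⁻¹' D) := measureReal_mono hcap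
    _ ≤ (sphereUniform n).real D + (sphereUniform n).real (R ⁻¹' D) := measureReal_union_le _ _
    _ = (sphereUniform n).real D + (sphereUniform n).real (J ⁻¹' D) := by rw [e1, e2]
    _ = (sphereUniform n).real (D ∪ J ⁻¹' D) :=
        (measureReal_union hdisj (hJp.measurable hDm)).symm
    _ ≤ _ := measureReal_mono (union_subset hDbad hJbad)

theorem isProbabilityMeasure_sampleLaw (hn : n ≠ 0) (hM : 1 ≤ M) :
    IsProbabilityMeasure (sampleLaw n M) := by
  have := isProbabilityMeasure_sphereUniform hn
  have : Nonempty (Fin M) := ⟨⟨0, hM⟩⟩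
  have : IsProbabilityMeasure (ProbabilityTheory.uniformOn (univ : Set (Fin M))) :=
    ProbabilityTheory.isProbabilityMeasure_uniformOn finite_univ univ_nonempty
  unfold sampleLaw
  infer_instance

theorem isProbabilityMeasure_sampleLawN (hn : n ≠ 0) (hM : 1 ≤ M) :
    IsProbabilityMeasure (sampleLawN n M N) := by
  have := isProbabilityMeasure_sampleLaw hn hM
  unfold sampleLawN
  infer_instance

theorem uniformOn_real_singleton (σ : Fin M) :
    (ProbabilityTheory.uniformOn (univ : Set (Fin M))).real {σ} = 1 / M := by
  rw [Measure.real, ProbabilityTheory.uniformOn_univ]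
  simp

/-- A given direction is bad with a probability controlled by Wendel's bound. -/
theorem sampleLawN_mem_badDirections_le (hn : 2 ≤ n) (hM : 1 ≤ M) (σ : Fin M) {r : ℝ}
    (hr0 : 0 < r) (hr : r < Real.pi / 2) {z : ℝ} (hz : 0 < z) (hz1 : z ≤ 1) (u : USphere n) :
    (sampleLawN n M N).real {ω | u ∈ badDirections ω σ r} ≤
      2 / (1 + z) * z⁻¹ ^ (n - 2) * (1 - (1 - z) * capMeasure n r / M) ^ N := by
  have hp := Real.pi_pos
  have := isProbabilityMeasure_sphereUniform (n := n) (by omega)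
  have := isProbabilityMeasure_sampleLaw (n := n) (by omega) hM
  have := isProbabilityMeasure_sampleLawN (n := n) (N := N) (by omega) hM
  have : IsProbabilityMeasure (ProbabilityTheory.uniformOn (univ : Set (Fin M))) :=
    ProbabilityTheory.isProbabilityMeasure_uniformOn finite_univ ⟨σ, trivial⟩
  have hu1 : ‖(u : Euc n)‖ = 1 := by simp
  have hcos : 0 < Real.cos r := Real.cos_pos_of_mem_Ioo ⟨by linarith, hr⟩
  -- Relevant samples have mode σ and lie near u or -u; `t` turns them towards u, and `T` reflects
  -- them through the line of u.
  set C : Set (USphere n × Fin M) :=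
    (sphereCap (u : Euc n) r ∪ sphereCap (-(u : Euc n)) r) ×ˢ {σ} with hC
  have hCm : MeasurableSet C := ((measurableSet_sphereCap _ _).union
    (measurableSet_sphereCap _ _)).prod (measurableSet_singleton σ)
  set t : USphere n × Fin M → Euc n := fun q =>
    if 0 ≤ inner ℝ (u : Euc n) (q.1 : Euc n) then (q.1 : Euc n) else -(q.1 : Euc n) with ht
  have hq : Measurable fun q : USphere n × Fin M => (q.1 : Euc n) := by fun_prop
  have htm : Measurable t := Measurable.ite
    (measurableSet_le measurable_const (measurable_const.inner hq)) hq hq.neg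
  set T : USphere n × Fin M → USphere n × Fin M :=
    Prod.map (sphereMap (ℝ ∙ (u : Euc n)).reflection) id with hT
  have hTp : MeasurePreserving T (sampleLaw n M) (sampleLaw n M) :=
    (measurePreserving_sphereMap (by omega) _).prod (MeasurePreserving.id _)
  have hTval : ∀ q, ((T q).1 : Euc n) = (ℝ ∙ (u : Euc n)).reflection q.1 := fun q => rfl
  have hTu : ∀ q, inner ℝ (u : Euc n) ((T q).1 : Euc n) = inner ℝ (u : Euc n) (q.1 : Euc n) := by
    intro q
    rw [hTval, inner_reflection_span hu1, real_inner_self_eq_norm_sq, hu1]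
    ring
  have hTC : ∀ q, T q ∈ C ↔ q ∈ C := by
    intro q
    simp only [hC, mem_prod, mem_union, sphereCap, mem_ofPred_eq, inner_neg_left, hTu]
    rfl
  have hflip : ∀ q ∈ C, ∀ e ∈ (ℝ ∙ (u : Euc n))ᗮ, inner ℝ e (t (T q)) = -inner ℝ e (t q) := by
    intro q _ e he
    have he0 : inner ℝ e (u : Euc n) = 0 :=
      Submodule.mem_orthogonal_singleton_iff_inner_left.1 he
    simp only [ht, hTu]
    split_ifs
    · rw [hTval, inner_reflection_span hu1, he0]; ring
    · rw [inner_neg_right, inner_neg_right, hTval, inner_reflection_span hu1, he0]; ring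
  -- Projecting e to u^⊥ subtracts (e·u)(u·y) ≥ 0 from e·y, so the products stay negative.
  have hsub : {ω | u ∈ badDirections ω σ r} ⊆ halfSpaceEvent C t (ℝ ∙ (u : Euc n))ᗮ N := by
    rintro ω ⟨e, he, h⟩
    refine ⟨e - inner ℝ e (u : Euc n) • (u : Euc n), ?_, fun i hi => ?_⟩
    · rw [Submodule.mem_orthogonal_singleton_iff_inner_left, inner_sub_left, real_inner_smul_left,
        real_inner_self_eq_norm_sq, hu1]
      ring
    · have hσ : (ω i).2 = σ := hi.2
      have hty : t (ω i) ∈ sampleVectors ω σ ∧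
          Real.cos r ≤ inner ℝ (u : Euc n) (t (ω i)) := by
        simp only [hC, mem_prod, mem_union, sphereCap, mem_ofPred_eq, inner_neg_left] at hi
        simp only [ht]
        split_ifs with h0
        · refine ⟨⟨i, hσ, Or.inl rfl⟩, ?_⟩
          rcases hi.1 with h1 | h1 <;> linarith
        · refine ⟨⟨i, hσ, Or.inr rfl⟩, ?_⟩
          rw [inner_neg_right]
          rcases hi.1 with h1 | h1 <;> linarith
      have h1 := h _ hty.1 hty.2
      rw [inner_sub_left, real_inner_smul_left]
      have := mul_nonneg he (hcos.le.trans hty.2)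
      linarith
  have hfr : Module.finrank ℝ (ℝ ∙ (u : Euc n))ᗮ = (n - 2) + 1 := by
    have : Fact (Module.finrank ℝ (Euc n) = (n - 2 + 1) + 1) :=
      ⟨by rw [finrank_euclideanSpace_fin]; omega⟩
    exact Submodule.finrank_orthogonal_span_singleton (norm_ne_zero_iff.1 (by rw [hu1]; simp))
  have hpC0 : 0 ≤ (sampleLaw n M).real C := measureReal_nonneg
  have hpC1 : (sampleLaw n M).real C ≤ 1 := measureReal_le_one
  have hpC : 2 * (capMeasure n r / M) ≤ (sampleLaw n M).real C := by
    have hdisj : Disjoint (sphereCap (u : Euc n) r) (sphereCap (-(u : Euc n)) r) := by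
      rw [Set.disjoint_left]
      intro x h1 h2
      simp only [sphereCap, mem_ofPred_eq, inner_neg_left] at h1 h2
      linarith
    rw [hC, sampleLaw, measureReal_prod_prod, measureReal_union hdisj (measurableSet_sphereCap _ _),
      uniformOn_real_singleton, mul_one_div, mul_div_assoc']
    refine div_le_div_of_nonneg_right ?_ (Nat.cast_nonneg M)
    have h1 := capMeasure_le_sphereUniform hn hu1 hr0 hr.le
    have h2 := capMeasure_le_sphereUniform hn (by rwa [norm_neg] : ‖-(u : Euc n)‖ = 1) hr0 hr.le
    linarith
  calc (sampleLawN n M N).real {ω | u ∈ badDirections ω σ r}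
      ≤ (Measure.pi fun _ : Fin N => sampleLaw n M).real
          (halfSpaceEvent C t (ℝ ∙ (u : Euc n))ᗮ N) := measureReal_mono hsub
    _ ≤ wendelBound ((sampleLaw n M).real C) N ((n - 2) + 1) := by
        rw [← hfr]
        exact measureReal_halfSpaceEvent_le _ hCm htm hTp hTC hflip N _ le_rfl
    _ ≤ 2 / (1 + z) * z⁻¹ ^ (n - 2) * (1 - (sampleLaw n M).real C * (1 - z) / 2) ^ N :=
        wendelBound_succ_le hpC0 hpC1 hz hz1 N (n - 2)
    _ ≤ _ := by
        have h1 : 0 ≤ 1 - (sampleLaw n M).real C * (1 - z) / 2 := by nlinarith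
        have h2 : (1 - z) * capMeasure n r / M ≤ (sampleLaw n M).real C * (1 - z) / 2 := by
          have := mul_le_mul_of_nonneg_left hpC (sub_nonneg.2 hz1)
          rw [mul_div_assoc]
          linarith
        gcongr

/-- With high probability, few directions are bad. -/
theorem sampleLawN_le_badDirections_le (hn : 2 ≤ n) (hM : 1 ≤ M) (σ : Fin M) {r m b : ℝ}
    (hm : 0 < m) (hb0 : 0 ≤ b)
    (hb : ∀ u : USphere n, (sampleLawN n M N).real {ω | u ∈ badDirections ω σ r} ≤ b) :
    (sampleLawN n M N).real {ω | m ≤ (sphereUniform n).real (badDirections ω σ r)} ≤ b / m := by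
  have := isProbabilityMeasure_sphereUniform (n := n) (by omega)
  have := isProbabilityMeasure_sampleLawN (n := n) (N := N) (by omega) hM
  have hS := measurableSet_badDirections (n := n) (N := N) σ r
  have hf := measurable_measure_prodMk_left (ν := sphereUniform n) hS
  -- Fubini: the mean measure of the bad directions is the average over u of the probability that u
  -- is bad.
  have hint : ∫⁻ ω, sphereUniform n (badDirections ω σ r) ∂(sampleLawN n M N) ≤
      ENNReal.ofReal b := by
    have h1 := Measure.prod_apply (μ := sampleLawN n M N) (ν := sphereUniform n) hS
    have h2 := Measure.prod_apply_symm (μ := sampleLawN n M N) (ν := sphereUniform n) hS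
    calc ∫⁻ ω, sphereUniform n (badDirections ω σ r) ∂(sampleLawN n M N)
        = ∫⁻ u, sampleLawN n M N {ω | u ∈ badDirections ω σ r} ∂(sphereUniform n) :=
          h1.symm.trans h2
      _ ≤ ∫⁻ _, ENNReal.ofReal b ∂(sphereUniform n) := by
          refine lintegral_mono fun u => ?_
          rw [ENNReal.le_ofReal_iff_toReal_le (by finiteness) hb0]
          exact hb u
      _ = ENNReal.ofReal b := by simp
  have hmark := (mul_meas_ge_le_lintegral hf (ENNReal.ofReal m)).trans hint
  have hset : {ω : Fin N → USphere n × Fin M | m ≤ (sphereUniform n).real (badDirections ω σ r)} =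
      {ω | ENNReal.ofReal m ≤ sphereUniform n (Prod.mk ω ⁻¹' {q | q.2 ∈ badDirections q.1 σ r})} := by
    ext ω
    simp only [mem_ofPred_eq]
    rw [ENNReal.ofReal_le_iff_le_toReal (by finiteness)]
    rfl
  rw [hset, le_div_iff₀ hm, mul_comm]
  have := ENNReal.toReal_mono (by finiteness) hmark
  rwa [ENNReal.toReal_mul, ENNReal.toReal_ofReal hm.le, ENNReal.toReal_ofReal hb0] at this

/-- The samples whose bad directions for the angle `r` have measure less than `m`. -/
def goodSamples (n M N : ℕ) (r m : ℝ) : Set (Fin N → USphere n × Fin M) :=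
  {ω | ∀ σ, (sphereUniform n).real (badDirections ω σ r) < m}

theorem measurableSet_goodSamples (hn : n ≠ 0) (r m : ℝ) :
    MeasurableSet (goodSamples n M N r m) := by
  have := isProbabilityMeasure_sphereUniform hn
  have hset : goodSamples n M N r m =
      ⋂ σ, {ω | (sphereUniform n).real (badDirections ω σ r) < m} := by
    ext ω; simp [goodSamples]
  rw [hset]
  refine MeasurableSet.iInter fun σ => measurableSet_lt ?_ measurable_const
  exact (measurable_measure_prodMk_left (ν := sphereUniform n)
    (measurableSet_badDirections (n := n) (N := N) σ r)).ennreal_toReal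

theorem one_sub_le_goodSamples (hn : 2 ≤ n) (hM : 1 ≤ M) {r m b : ℝ} (hm : 0 < m) (hb0 : 0 ≤ b)
    (hb : ∀ (σ : Fin M) (u : USphere n),
      (sampleLawN n M N).real {ω | u ∈ badDirections ω σ r} ≤ b) :
    1 - M * (b / m) ≤ (sampleLawN n M N).real (goodSamples n M N r m) := by
  have := isProbabilityMeasure_sampleLawN (n := n) (N := N) (by omega) hM
  have hG := measurableSet_goodSamples (n := n) (M := M) (N := N) (by omega) r m
  have hcompl : (sampleLawN n M N).real (goodSamples n M N r m)ᶜ ≤ M * (b / m) := by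
    have hsub : (goodSamples n M N r m)ᶜ ⊆
        ⋃ σ : Fin M, {ω | m ≤ (sphereUniform n).real (badDirections ω σ r)} := by
      intro ω hω
      simpa [goodSamples] using hω
    calc _ ≤ (sampleLawN n M N).real
          (⋃ σ : Fin M, {ω | m ≤ (sphereUniform n).real (badDirections ω σ r)}) :=
          measureReal_mono hsub
      _ ≤ ∑ σ : Fin M, (sampleLawN n M N).real
          {ω | m ≤ (sphereUniform n).real (badDirections ω σ r)} :=
          measureReal_iUnion_fintype_le _
      _ ≤ ∑ _σ : Fin M, b / m := Finset.sum_le_sum fun σ _ =>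
          sampleLawN_le_badDirections_le hn hM σ hm hb0 (hb σ)
      _ = M * (b / m) := by simp
  rw [probReal_compl_eq_one_sub hG] at hcompl
  linarith

end BadDirections

/-! ### Comparison with the failure bound and conclusion -/

/-- With q = (1 - ε/M)^N, the decay factor in Wendel's bound is at most q^c, and the spare q^(c-1) ≤
cap(θ/2)^(c-1) cancels the prefactor. -/
theorem wendel_le_failure {n M N : ℕ} (hn : 2 ≤ n) (hM : 1 ≤ M) {θ : ℝ} (h0 : 0 < θ)
    (h1 : θ ≤ Real.pi / 4) {ε : ℝ} (hε : ε ∈ Ioo (0 : ℝ) (1 / 2)) (hθε : capMeasure n θ = ε)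
    (hq : (1 - ε / M) ^ N ≤ capMeasure n (θ / 2)) :
    ∃ z : ℝ, 0 < z ∧ z ≤ 1 ∧
      0 ≤ 2 / (1 + z) * z⁻¹ ^ (n - 2) * (1 - (1 - z) * capMeasure n (3 * θ / 2) / M) ^ N ∧
      2 / (1 + z) * z⁻¹ ^ (n - 2) * (1 - (1 - z) * capMeasure n (3 * θ / 2) / M) ^ N ≤
        (1 - ε / M) ^ N := by
  obtain ⟨z, c, hz, hz1, hc1, hc, hK⟩ := exists_wendel_parameters hn h0 h1
  have hp := Real.pi_pos
  have hM' : (1 : ℝ) ≤ M := by exact_mod_cast hM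
  have hM0 : (0 : ℝ) < M := by linarith
  have hεM0 : 0 < ε / M := div_pos hε.1 hM0
  have hεM : ε / M < 1 := by
    rw [div_lt_one hM0]; linarith [hε.2]
  have hcap : capMeasure n (3 * θ / 2) ≤ 1 / 2 := by
    rw [← capMeasure_pi_div_two n]
    exact (strictMonoOn_capMeasure n).monotoneOn ⟨by linarith, by linarith⟩
      ⟨by linarith, by linarith⟩ (by linarith)
  have hcap0 : 0 ≤ capMeasure n (3 * θ / 2) := by
    rw [← capMeasure_zero n]
    exact (strictMonoOn_capMeasure n).monotoneOn ⟨le_rfl, hp.le⟩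
      ⟨by linarith, by linarith⟩ (by linarith)
  have hbase : 0 ≤ 1 - (1 - z) * capMeasure n (3 * θ / 2) / M := by
    rw [sub_nonneg, div_le_one hM0]
    nlinarith
  refine ⟨z, hz, hz1, by positivity, ?_⟩
  set q := (1 - ε / M) ^ N with hqdef
  have hb1 : 0 < 1 - ε / M := by linarith
  have hqpos : 0 < q := pow_pos hb1 N
  -- Bernoulli's inequality: 1 - c ε/M ≤ (1 - ε/M)^c.
  have hle : 1 - (1 - z) * capMeasure n (3 * θ / 2) / M ≤ (1 - ε / M) ^ c := by
    have hbern := one_add_mul_self_le_rpow_one_add (s := -(ε / M)) (by linarith) hc1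
    rw [← sub_eq_add_neg] at hbern
    refine le_trans ?_ hbern
    have : c * (ε / M) ≤ (1 - z) * capMeasure n (3 * θ / 2) / M := by
      rw [mul_div_assoc', ← hθε]
      exact div_le_div_of_nonneg_right hc hM0.le
    linarith
  have hpow : (1 - (1 - z) * capMeasure n (3 * θ / 2) / M) ^ N ≤ q * q ^ (c - 1) := by
    refine (pow_le_pow_left₀ hbase hle N).trans_eq ?_
    rw [← Real.rpow_natCast, ← Real.rpow_mul hb1.le, mul_comm, Real.rpow_mul hb1.le,
      Real.rpow_natCast, ← hqdef, Real.rpow_sub_one hqpos.ne']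
    field_simp
  have hqc : q ^ (c - 1) ≤ capMeasure n (θ / 2) ^ (c - 1) :=
    Real.rpow_le_rpow hqpos.le hq (by linarith)
  calc _ ≤ 2 / (1 + z) * z⁻¹ ^ (n - 2) * (q * capMeasure n (θ / 2) ^ (c - 1)) := by
        gcongr
        exact hpow.trans (mul_le_mul_of_nonneg_left hqc hqpos.le)
    _ = q * (2 / (1 + z) * z⁻¹ ^ (n - 2) * capMeasure n (θ / 2) ^ (c - 1)) := by ring
    _ ≤ q := mul_le_of_le_one_right hqpos.le hK

theorem theorem2 (n M N : ℕ) (hn : 2 ≤ n) (hM : 1 ≤ M)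
    (A : Fin M → Matrix (Fin n) (Fin n) ℝ) (hA : jointSpectralRadius A < 1)
    (X : Set (Euc n)) (hX : IsCPolytope X)
    (ε : ℝ) (hε : ε ∈ Ioo (0 : ℝ) (1 / 2)) (hθ : 2 * capTheta n ε < Real.pi / 2) :
    ∃ G : Set (Fin N → USphere n × Fin M),
      MeasurableSet G ∧
      1 - failureBound n M N ε ≤ (sampleLawN n M N).real G ∧
      ∀ ω ∈ G, IsContractive A
        (1 / gammaLower (dataHullLimit A X ω) (doubledMeasure n ε)) (dataHullLimit A X ω) := by
  have hp := Real.pi_pos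
  obtain ⟨hθ0, hθ2, hθε⟩ := capTheta_spec hn hε
  obtain ⟨hdθ, hdδ⟩ := capTheta_doubledMeasure hn hε hθ
  set θ := capTheta n ε with hθdef
  have hm : 0 < capMeasure n (θ / 2) := by
    rw [← capMeasure_zero n]
    exact strictMonoOn_capMeasure n ⟨le_rfl, hp.le⟩ ⟨by linarith, by linarith⟩ (by linarith)
  have hM' : (1 : ℝ) ≤ M := by exact_mod_cast hM
  have hq0 : 0 ≤ (1 - ε / M) ^ N := by
    refine pow_nonneg ?_ N
    rw [sub_nonneg, div_le_one (by linarith)]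
    linarith [hε.2]
  rw [failureBound_eq hn M N hε, ← hθdef]
  by_cases hB : 1 ≤ M * (1 - ε / M) ^ N / capMeasure n (θ / 2)
  -- If the failure bound is at least 1, the empty event will do. Otherwise, as M ≥ 1, (1 - ε/M)^N
  -- is below cap(θ/2), which `wendel_le_failure` needs.
  · refine ⟨∅, MeasurableSet.empty, ?_, by simp⟩
    rw [measureReal_empty]
    linarith
  rw [not_le, div_lt_one hm] at hB
  have hq : (1 - ε / M) ^ N ≤ capMeasure n (θ / 2) := by nlinarith
  obtain ⟨z, hz, hz1, hb0, hb⟩ := wendel_le_failure hn hM hθ0 (by linarith) hε hθε hq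
  refine ⟨goodSamples n M N (3 * θ / 2) (capMeasure n (θ / 2)),
    measurableSet_goodSamples (by omega) _ _, ?_, fun ω hω x hx σ => ?_⟩
  · refine le_trans ?_ (one_sub_le_goodSamples hn hM hm hq0 fun σ u =>
      (sampleLawN_mem_badDirections_le hn hM σ (by linarith) (by linarith) hz hz1 u).trans hb)
    rw [mul_div_assoc]
  · refine map_mem_smul_of_spread (by omega) (convex_dataHullLimit hX ω)
      (isCompact_dataHullLimit hA hX ω) (dataHullLimit_mem_nhds hX ω) (act (A σ))
      (finite_sampleVectors ω σ) (fun y hy => norm_of_mem_sampleVectors hy)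
      (fun y hy => gauge_act_le_of_mem_sampleVectors hA hX hy) (by rw [hdθ, hdδ]) ?_ ?_ hx
    · rw [hdθ]
      exact Real.cos_pos_of_mem_Ioo ⟨by linarith, hθ⟩
    · intro v e hv he
      rw [hdθ]
      by_contra! hcon
      -- A direction bad for 2θ would make the bad directions for 3θ/2 too large for a good sample.
      have hbad : (⟨v, by simpa using hv⟩ : USphere n) ∈ badDirections ω σ (θ / 2 + 3 * θ / 2) := by
        refine ⟨e, he, fun y hy hyr => hcon y hy ?_⟩
        rwa [show θ / 2 + 3 * θ / 2 = 2 * θ by ring] at hyr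
      exact absurd (hω σ) (not_lt.2 (capMeasure_le_badDirections hn (by linarith) (by linarith)
        (by linarith) hbad))
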